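/- Convention. A group $G$ is a convergence group if it acts by homeomorphisms on a compact metrizable space $M$ with at least three points such that every sequence $(\gamma_n)$ of pairwise distinct elements of $G$ has a subsequence $(\gamma_{\sigma(n)})$ for which there are points $\xi,\eta\in M$ (possibly equal) such that, for every compact $K\subset M\setminus\{\eta\}$, the restrictions $\gamma_{\sigma(n)}|_K$ converge uniformly to the constant $\xi$. It is a non-elementary convergence group if there is such an action for which, moreover, $G$ is infinite and no non-empty subset of $M$ with at most two points is $G$-invariant. Proposition. Let $\Gamma$ be the fundamental group of a finite connected graph of groups in which every vertex group is a torsion-free countable convergence group and every edge group is infinite cyclic. Then $\Gamma$ is a convergence group. If moreover at least one of the vertex groups is a non-elementary convergence group, then $\Gamma$ is a non-elementary convergence group. -/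

import Mathlib

open Filter Topology

/-! ### Convergence groups -/

/-- `G` acts on `M` as a convergence group: every sequence of pairwise distinct elements of `G`
has a subsequence `γ (σ n)` for which there are points `ξ, η` of `M` (possibly equal) such that
`γ (σ n)` converges to the constant `ξ`, uniformly on each compact subset of `M ∖ {η}`. Uniform
convergence to a constant is expressed by neighbourhoods of that constant. -/
def IsConvergenceAction (G M : Type*) [Group G] [TopologicalSpace M] [MulAction G M] : Prop :=
  ∀ γ : ℕ → G, Function.Injective γ →
    ∃ σ : ℕ → ℕ, StrictMono σ ∧ ∃ ξ η : M, ∀ K : Set M, IsCompact K → η ∉ K →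
      ∀ U ∈ 𝓝 ξ, ∀ᶠ n in atTop, ∀ x ∈ K, γ (σ n) • x ∈ U

/-- The action of `G` on `M` is non-elementary: `G` is infinite and leaves no non-empty subset of
`M` with at most two points invariant. -/
def IsNonelementaryAction (G M : Type*) [Group G] [MulAction G M] : Prop :=
  Infinite G ∧ ∀ F : Set M, F.Nonempty → F.encard ≤ 2 → ∃ g : G, ∃ x ∈ F, g • x ∉ F

/-- `G` is a convergence group: it acts by homeomorphisms on a compact metrizable space with at
least three points as a convergence group. (A compact metrizable space has at most continuum many
points, so it is no restriction to take the space in the lowest universe.) -/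
def IsConvergenceGroup (G : Type*) [Group G] : Prop :=
  ∃ (M : Type) (_ : TopologicalSpace M) (_ : MulAction G M),
    CompactSpace M ∧ TopologicalSpace.MetrizableSpace M ∧ ContinuousConstSMul G M ∧
      3 ≤ ENat.card M ∧ IsConvergenceAction G M

/-- `G` is a non-elementary convergence group: it has a non-elementary convergence action by
homeomorphisms on a compact metrizable space with at least three points. -/
def IsNonelementaryConvergenceGroup (G : Type*) [Group G] : Prop :=
  ∃ (M : Type) (_ : TopologicalSpace M) (_ : MulAction G M),
    CompactSpace M ∧ TopologicalSpace.MetrizableSpace M ∧ ContinuousConstSMul G M ∧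
      3 ≤ ENat.card M ∧ IsConvergenceAction G M ∧ IsNonelementaryAction G M

/-! ### Graphs of groups -/

/-- A graph of groups on the vertex set `V` and the set `E` of geometric edges (loops and multiple
edges are allowed), each edge `e` carrying a chosen orientation from `src e` to `tgt e`: vertex
groups `G v`, edge groups `A e`, and monomorphisms of each edge group into the groups of its two
end points. -/
structure GraphOfGroups.{u₁, u₂, u₃, u₄} (V : Type u₁) (E : Type u₂) where
  src : E → V
  tgt : E → V
  G : V → Type u₃
  A : E → Type u₄
  [groupG : ∀ v, Group (G v)]
  [groupA : ∀ e, Group (A e)]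
  toSrc : ∀ e, A e →* G (src e)
  toTgt : ∀ e, A e →* G (tgt e)
  toSrc_injective : ∀ e, Function.Injective (toSrc e)
  toTgt_injective : ∀ e, Function.Injective (toTgt e)

namespace GraphOfGroups

attribute [instance] GraphOfGroups.groupG GraphOfGroups.groupA

variable {V E : Type*} (Y : GraphOfGroups V E)

/-- Any two vertices are joined by a path (of unoriented edges) all of whose edges lie in `S`. -/
def Connects (S : Set E) : Prop :=
  ∀ v w : V, Relation.EqvGen (fun a b => ∃ e ∈ S, Y.src e = a ∧ Y.tgt e = b) v w

/-- `T` is the edge set of a spanning (maximal) tree of the underlying graph: it connects all the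
vertices and no proper subset of it does. -/
def IsSpanningTree (T : Set E) : Prop :=
  Minimal Y.Connects T

/-- The free product of all the vertex groups and of the free group on the edges. -/
abbrev FreeProd : Type _ :=
  Monoid.Coprod (Monoid.CoprodI Y.G) (FreeGroup E)

/-- The vertex group `G v` in the free product. -/
def vert (v : V) : Y.G v →* Y.FreeProd :=
  Monoid.Coprod.inl.comp Monoid.CoprodI.of

/-- The letter of the edge `e` in the free product. -/
def letter (e : E) : Y.FreeProd :=
  Monoid.Coprod.inr (FreeGroup.of e)

/-- The defining relators: `t_e * toTgt a * t_e⁻¹ = toSrc a` for each edge `e` and each element `a`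
of its edge group, and `t_e = 1` for each edge `e` of the tree `T`. -/
def relators (T : Set E) : Set Y.FreeProd :=
  {r | ∃ (e : E) (a : Y.A e), r = Y.letter e * Y.vert (Y.tgt e) (Y.toTgt e a) * (Y.letter e)⁻¹ *
      (Y.vert (Y.src e) (Y.toSrc e a))⁻¹} ∪
    {r | ∃ e ∈ T, r = Y.letter e}

/-- The fundamental group of the graph of groups `Y` relative to the spanning tree `T` (up to
isomorphism it does not depend on the spanning tree). -/
abbrev PiOne (T : Set E) : Type _ :=
  Y.FreeProd ⧸ Subgroup.normalClosure (Y.relators T)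

end GraphOfGroups

/-! The first assertion is soft: a countably infinite group acts by left translation on its
one-point compactification, where injective sequences collapse to the point at infinity, and a
finite group has no injective sequences at all. All the rest serves the second assertion.

An infinite convergence group has no finite invariant set with more than two points, so a
non-elementary vertex group preserves no finite non-empty set. This stronger form (`IsWildAction`)
is carried along, because it survives both operations used below: equivariant quotients with finite
fibres, and gluing.

Gluing takes translates of a space `M` along a Bass-Serre tree. A point of the result is a
compatible family of projections to the translates (`directionSpace`), so that compactness,
metrizability and convergence can be checked coordinatewise. Convergence
(`IsDirectionSystem.isConvergenceAction`) needs the points of `M` at which other translates are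
attached to be nonconical: a sequence collapsing to ξ must send them to ξ even if they are
exceptional.

For an infinite cyclic edge group, the attaching point must also be fixed by a generator `c`. A
subsequence of the powers of `c` collapses to a point `a` off a point `b`, both fixed by `c`. If `a
= b`, this point is nonconical (`isNonconical_of_parabolic`). If not, translates of the pair `{a,
b}` are discrete in the space of distinct pairs (`exists_frequently_smul_pair_eq`); identifying the
two points of each translate gives a compact metrizable quotient in which the image of `a` is
nonconical.

Amalgams are avoided. All vertex groups are put into one free product, and every edge, including
those of the tree, contributes an HNN extension. A potential on the tree exhibits the fundamental
group as a retract, hence a subgroup, of the resulting group, and the wild action restricts to it.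
-/

/-! ### Subsequences -/

/-- A diagonal argument: countably many properties of subsequences, each of which can be achieved
by passing to a further subsequence, can be achieved simultaneously. -/
theorem exists_diagonal_subsequence {ι : Type*} [Countable ι] (P : ι → Filter ℕ → Prop)
    (hanti : ∀ i l l', l ≤ l' → P i l' → P i l)
    (h : ∀ i (φ : ℕ → ℕ), StrictMono φ → ∃ ψ : ℕ → ℕ, StrictMono ψ ∧ P i (map (φ ∘ ψ) atTop)) :
    ∃ φ : ℕ → ℕ, StrictMono φ ∧ ∀ i, P i (map φ atTop) := by
  rcases isEmpty_or_nonempty ι with hι | hι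
  · exact ⟨id, strictMono_id, fun i => hι.elim i⟩
  obtain ⟨e, he⟩ := exists_surjective_nat ι
  choose! ψ hψ hP using h
  let Φ : ℕ → ℕ → ℕ := fun n => Nat.rec id (fun k φ => φ ∘ ψ (e k) φ) n
  have hΦs : ∀ n, Φ (n + 1) = Φ n ∘ ψ (e n) (Φ n) := fun n => rfl
  have hΦ : ∀ n, StrictMono (Φ n) := by
    intro n
    induction n with
    | zero => exact strictMono_id
    | succ n ih => rw [hΦs]; exact ih.comp (hψ _ _ ih)
  -- Stage `k + m` refines stage `k`, so from index `k + 1` on the diagonal runs through values of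
  -- `Φ (k + 1)`, for which the property of `e k` has been secured.
  have hfac : ∀ k m, ∃ θ : ℕ → ℕ, StrictMono θ ∧ Φ (k + m) = Φ k ∘ θ := by
    intro k m
    induction m with
    | zero => exact ⟨id, strictMono_id, rfl⟩
    | succ m ih =>
      obtain ⟨θ, hθ, h1⟩ := ih
      refine ⟨θ ∘ ψ (e (k + m)) (Φ (k + m)), hθ.comp (hψ _ _ (hΦ _)), ?_⟩
      rw [← add_assoc, hΦs, h1]; rfl
  refine ⟨fun n => Φ n n, strictMono_nat_of_lt_succ fun n => ?_, fun i => ?_⟩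
  · rw [hΦs]
    exact (hΦ n (Nat.lt_succ_self n)).trans_le ((hΦ n).monotone ((hψ _ _ (hΦ n)).id_le _))
  · obtain ⟨k, rfl⟩ := he i
    refine hanti _ _ _ ?_ (hP (e k) (Φ k) (hΦ k))
    rw [← hΦs]
    intro s hs
    rw [mem_map, mem_atTop_sets] at hs ⊢
    obtain ⟨a, ha⟩ := hs
    refine ⟨max a (k + 1), fun n hn => ?_⟩
    obtain ⟨m, rfl⟩ := Nat.exists_eq_add_of_le ((le_max_right _ _).trans hn)
    obtain ⟨θ, hθ, h1⟩ := hfac (k + 1) m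
    simp only [Set.mem_preimage, h1]
    exact ha _ (((le_max_left _ _).trans hn).trans (hθ.id_le _))

/-- Every sequence in a countable type has a constant or an injective subsequence. -/
theorem exists_subsequence_const_or_injective {X : Type*} [Countable X] (u : ℕ → X) :
    ∃ φ : ℕ → ℕ, StrictMono φ ∧ ((∃ x, ∀ n, u (φ n) = x) ∨ Function.Injective (u ∘ φ)) := by
  by_cases h : ∃ x, ∃ᶠ n in atTop, u n = x
  · obtain ⟨x, hx⟩ := h
    obtain ⟨φ, hφ, h'⟩ := extraction_of_frequently_atTop hx
    exact ⟨φ, hφ, Or.inl ⟨x, h'⟩⟩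
  · push Not at h
    obtain ⟨f, hf⟩ := exists_injective_nat X
    have h1 : Tendsto u atTop cofinite := by
      intro s hs
      have hs' : sᶜ.Finite := hs
      have : ∀ᶠ n in atTop, ∀ x ∈ sᶜ, u n ≠ x :=
        (eventually_all_finite hs').2 fun x _ => h x
      rw [mem_map]
      filter_upwards [this] with n hn
      by_contra hc
      exact hn _ hc rfl
    have h2 : Tendsto (f ∘ u) atTop atTop := by
      rw [← Nat.cofinite_eq_atTop]
      rw [← Nat.cofinite_eq_atTop] at h1
      exact hf.tendsto_cofinite.comp h1
    obtain ⟨φ, hφ, h3⟩ := strictMono_subseq_of_tendsto_atTop h2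
    exact ⟨φ, hφ, Or.inr fun a b hab => h3.injective (congrArg f hab)⟩

/-! ### Collapsing sequences -/

/-- The sequence `γ` converges to the constant `ξ`, locally uniformly on the complement of `η`. -/
def Collapses {G M : Type*} [TopologicalSpace M] [SMul G M] (γ : ℕ → G) (ξ η : M) : Prop :=
  ∀ x, x ≠ η → Tendsto (fun q : ℕ × M => γ q.1 • q.2) (atTop ×ˢ 𝓝 x) (𝓝 ξ)

/-- Sequences collapsing to `ξ` attract `p`, even if `p` is the exceptional point: the point `p` is
not a conical limit point. -/
def IsNonconical (G : Type*) {M : Type*} [TopologicalSpace M] [SMul G M] (p : M) : Prop :=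
  ∀ (γ : ℕ → G) (ξ η : M), Function.Injective γ → Collapses γ ξ η →
    Tendsto (fun n => γ n • p) atTop (𝓝 ξ)

section Collapses

variable {G M : Type*} [Group G] [TopologicalSpace M] [MulAction G M]

theorem Collapses.tendsto {γ : ℕ → G} {ξ η x : M} (h : Collapses γ ξ η) {u : ℕ → M}
    (hu : Tendsto u atTop (𝓝 x)) (hx : x ≠ η) : Tendsto (fun n => γ n • u n) atTop (𝓝 ξ) :=
  (h x hx).comp (tendsto_id.prodMk hu)

theorem Collapses.tendsto_const {γ : ℕ → G} {ξ η x : M} (h : Collapses γ ξ η)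
    (hx : x ≠ η) : Tendsto (fun n => γ n • x) atTop (𝓝 ξ) :=
  h.tendsto tendsto_const_nhds hx

theorem Collapses.comp {γ : ℕ → G} {ξ η : M} (h : Collapses γ ξ η) {φ : ℕ → ℕ}
    (hφ : Tendsto φ atTop atTop) : Collapses (γ ∘ φ) ξ η := fun x hx =>
  (h x hx).comp (hφ.prodMap tendsto_id)

theorem Collapses.eventually_compact {γ : ℕ → G} {ξ η : M} (h : Collapses γ ξ η) {K : Set M}
    (hK : IsCompact K) (hη : η ∉ K) {U : Set M} (hU : U ∈ 𝓝 ξ) :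
    ∀ᶠ n in atTop, ∀ x ∈ K, γ n • x ∈ U := by
  refine hK.induction_on (p := fun s => ∀ᶠ n in atTop, ∀ x ∈ s, γ n • x ∈ U) (by simp)
    (fun s t hst ht => ht.mono fun n hn x hx => hn x (hst hx))
    (fun s t hs ht => by
      filter_upwards [hs, ht] with n h1 h2 x hx using hx.elim (h1 x) (h2 x)) fun x hx => ?_
  obtain ⟨A, hA, t, ht, hAt⟩ := mem_prod_iff.1 (h x (fun e => hη (e ▸ hx)) hU)
  exact ⟨t, mem_nhdsWithin_of_mem_nhds ht,
    mem_of_superset hA fun n hn y hy => hAt (Set.mk_mem_prod hn hy)⟩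

theorem collapses_iff_compact [CompactSpace M] [T2Space M] {γ : ℕ → G} {ξ η : M} :
    Collapses γ ξ η ↔ ∀ K : Set M, IsCompact K → η ∉ K → ∀ U ∈ 𝓝 ξ,
      ∀ᶠ n in atTop, ∀ x ∈ K, γ n • x ∈ U := by
  refine ⟨fun h K hK hη U hU => h.eventually_compact hK hη hU, fun h x hx U hU => ?_⟩
  have hx' : ({η}ᶜ : Set M) ∈ 𝓝 x := isOpen_compl_singleton.mem_nhds hx
  obtain ⟨K, hK, hKη, hKc⟩ := LocallyCompactSpace.local_compact_nhds x _ hx'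
  have := h K hKc (fun hη => hKη hη rfl) U hU
  rw [mem_map, mem_prod_iff]
  exact ⟨_, this, K, hK, fun q hq => hq.1 _ hq.2⟩

theorem isConvergenceAction_iff [CompactSpace M] [T2Space M] :
    IsConvergenceAction G M ↔ ∀ γ : ℕ → G, Function.Injective γ →
      ∃ σ : ℕ → ℕ, StrictMono σ ∧ ∃ ξ η : M, Collapses (γ ∘ σ) ξ η := by
  simp only [IsConvergenceAction, collapses_iff_compact, Function.comp_apply]

/-- If `γ n` sends the complement of a neighbourhood `V` of η into the complement of `K`, then `(γ
n)⁻¹` sends `K` into `V`. -/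
theorem Collapses.inv [CompactSpace M] [T2Space M] {γ : ℕ → G} {ξ η : M}
    (h : Collapses γ ξ η) : Collapses (fun n => (γ n)⁻¹) η ξ := by
  rw [collapses_iff_compact] at h ⊢
  intro K hK hξ U hU
  obtain ⟨V, hVU, hV, hηV⟩ := mem_nhds_iff.1 hU
  filter_upwards [h Vᶜ hV.isClosed_compl.isCompact (fun hc => hc hηV) Kᶜ
    (hK.isClosed.isOpen_compl.mem_nhds hξ)] with n hn x hx
  by_contra hc
  exact hn _ (fun hv => hc (hVU hv)) (by simpa using hx)

theorem Collapses.eq_left [T2Space M] [Infinite M] {γ : ℕ → G} {ξ η ξ' η' : M}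
    (h : Collapses γ ξ η) (h' : Collapses γ ξ' η') : ξ = ξ' := by
  obtain ⟨z, hz⟩ := (Set.toFinite {η, η'}).exists_notMem
  simp only [Set.mem_insert_iff, Set.mem_singleton_iff, not_or] at hz
  exact tendsto_nhds_unique (h.tendsto_const hz.1) (h'.tendsto_const hz.2)

theorem Collapses.eq_right [CompactSpace M] [T2Space M] [Infinite M] {γ : ℕ → G} {ξ η ξ' η' : M}
    (h : Collapses γ ξ η) (h' : Collapses γ ξ' η') : η = η' :=
  h.inv.eq_left h'.inv

theorem Collapses.mul_left [ContinuousConstSMul G M] {γ : ℕ → G} {ξ η : M}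
    (h : Collapses γ ξ η) (a : G) : Collapses (fun n => a * γ n) (a • ξ) η := by
  intro x hx
  simp only [mul_smul]
  exact (h x hx).const_smul a

theorem Collapses.mul_right [ContinuousConstSMul G M] {γ : ℕ → G} {ξ η : M}
    (h : Collapses γ ξ η) (a : G) : Collapses (fun n => γ n * a) ξ (a⁻¹ • η) := by
  intro x hx
  simp only [mul_smul]
  have h1 : a • x ≠ η := fun e => hx (by rw [← e, inv_smul_smul])
  exact (h _ h1).comp (tendsto_id.prodMap ((continuous_const_smul a).tendsto x))

theorem IsNonconical.smul [ContinuousConstSMul G M] {p : M} (hp : IsNonconical G p) (a : G) :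
    IsNonconical G (a • p) := by
  intro γ ξ η hγ h
  have := hp (fun n => γ n * a) ξ _ (fun m n e => hγ (mul_right_cancel e)) (h.mul_right a)
  simpa only [mul_smul] using this

theorem IsConvergenceAction.exists_collapses [CompactSpace M] [T2Space M]
    (h : IsConvergenceAction G M) {γ : ℕ → G} (hγ : Function.Injective γ) :
    ∃ σ : ℕ → ℕ, StrictMono σ ∧ ∃ ξ η : M, Collapses (γ ∘ σ) ξ η :=
  isConvergenceAction_iff.1 h γ hγ

/-- An infinite convergence group has no finite invariant set with more than two points. -/
theorem IsConvergenceAction.encard_le_two [CompactSpace M] [T2Space M] [Infinite G]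
    (h : IsConvergenceAction G M) {F : Set M} (hF : F.Finite)
    (hinv : ∀ g : G, ∀ x ∈ F, g • x ∈ F) : F.encard ≤ 2 := by
  obtain ⟨σ, hσ, ξ, η, hc⟩ := h.exists_collapses (Infinite.natEmbedding G).injective
  by_contra hlt
  have h1 : 1 < (F \ {η}).encard := by
    have := Set.encard_le_encard_sdiff_add_encard F {η}
    rw [Set.encard_singleton] at this
    by_contra h1
    exact hlt (this.trans ((add_le_add_left (not_lt.1 h1) 1).trans (by norm_num)))
  obtain ⟨x, y, hx, hy, hxy⟩ := Set.one_lt_encard_iff.1 h1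
  -- As `F` is finite, some neighbourhood of ξ meets it at most in ξ; two points of `F` other than η
  -- are then eventually both sent to ξ.
  have hU : (F \ {ξ})ᶜ ∈ 𝓝 ξ := (hF.subset Set.sdiff_subset).isClosed.isOpen_compl.mem_nhds (by simp)
  have key : ∀ z ∈ F \ {η}, ∀ᶠ n in atTop, (Infinite.natEmbedding G (σ n)) • z = ξ := by
    intro z hz
    filter_upwards [hc.tendsto_const hz.2 hU] with n hn
    by_contra hne
    exact hn ⟨hinv _ _ hz.1, hne⟩
  obtain ⟨n, hn1, hn2⟩ := ((key x hx).and (key y hy)).exists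
  exact hxy (smul_left_cancel _ (hn1.trans hn2.symm))

end Collapses

/-! ### Parabolic fixed points and loxodromic pairs -/

section FixedPoints

variable {G M : Type*} [Group G] [TopologicalSpace M] [MulAction G M]

theorem zpow_smul_of_smul_eq {G M : Type*} [Group G] [MulAction G M] {c : G} {x : M}
    (h : c • x = x) (j : ℤ) : c ^ j • x = x :=
  MulAction.mem_fixedBy_zpow (MulAction.mem_fixedBy.2 h) j

/-- Conjugates of a parabolic element cannot collapse towards a loxodromic dynamics. -/
theorem not_collapses_conj_of_parabolic [CompactSpace M] [T2Space M] [Infinite M]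
    [ContinuousConstSMul G M] {g : ℕ → G} {c : G} {p ξ β : M} {k : ℕ → ℕ} (hc : Collapses (fun n => c ^ k n) p p)
    (hcol : Collapses g ξ p) (hβ : Tendsto (fun n => g n • p) atTop (𝓝 β)) (hne : β ≠ ξ) :
    ¬ Collapses (fun n => g n * c * (g n)⁻¹) ξ β := by
  intro hh
  obtain ⟨z, hz⟩ := (Set.finite_singleton p).exists_notMem
  obtain ⟨B, A, hB, hA, hβB, hξA, hAB⟩ := t2_separation hne
  have h1 := hh.eventually_compact (K := Bᶜ) hB.isClosed_compl.isCompact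
    (fun h => h hβB) (hA.mem_nhds hξA)
  have h2 := (hcol.tendsto_const hz) (hA.mem_nhds hξA)
  have h3 := hβ (hB.mem_nhds hβB)
  obtain ⟨n, h1, h2, h3⟩ := (h1.and (Eventually.and h2 h3)).exists
  have hAB' : ∀ x ∈ A, x ∉ B := fun x hx hx' => hAB.le_bot ⟨hx', hx⟩
  -- The conjugate of `c` by `g n` maps the complement of `B` into `A`, which traps the orbit; but
  -- `c ^ k m • z` tends to `p`, which `g n` sends into `B`.
  have key : ∀ m : ℕ, g n • c ^ m • z ∈ A := by
    intro m
    induction m with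
    | zero => simpa using h2
    | succ m ih =>
      have := h1 _ (hAB' _ ih)
      rw [smul_smul, inv_mul_cancel_right, mul_smul, smul_smul c, ← pow_succ'] at this
      exact this
  have h4 := (hc.tendsto_const hz).const_smul (g n)
  obtain ⟨m, hm⟩ := (h4.eventually_mem (hB.mem_nhds h3)).exists
  exact hAB' _ (key _) hm

/-- A parabolic fixed point is not a conical limit point. -/
theorem isNonconical_of_parabolic [Countable G] [CompactSpace M] [T2Space M]
    [FirstCountableTopology M] [Infinite M] [ContinuousConstSMul G M]
    (hG : IsConvergenceAction G M) {c : G} {p : M} (hcp : c • p = p) {k : ℕ → ℕ}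
    (hc : Collapses (fun n => c ^ k n) p p) : IsNonconical G p := by
  intro γ ξ η hγ hcol
  refine tendsto_of_subseq_tendsto fun ns hns => ?_
  obtain ⟨β, ms, hms, hβ⟩ := CompactSpace.tendsto_subseq (fun n => γ (ns n) • p)
  refine ⟨ms, ?_⟩
  suffices β = ξ from this ▸ hβ
  by_contra hne
  replace hcol := hcol.comp (hns.comp hms.tendsto_atTop)
  set g : ℕ → G := γ ∘ (ns ∘ ms) with hg
  change Tendsto (fun n => g n • p) atTop (𝓝 β) at hβ
  clear_value g
  have hη : p = η := by
    by_contra h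
    exact hne (tendsto_nhds_unique hβ (hcol.tendsto_const h))
  subst hη
  have hfix : ∀ x : M, c • x = x → x = p := by
    intro x hx
    by_contra hxp
    have h1 := hc.tendsto_const hxp
    have h2 : ∀ n, c ^ k n • x = x := fun n => by
      rw [← zpow_natCast, zpow_smul_of_smul_eq hx]
    simp only [h2] at h1
    exact hxp (tendsto_nhds_unique tendsto_const_nhds h1)
  -- The conjugates of `c` fix `g n • p`, which tends to β, and move `g n • z` to `g n • c • z`,
  -- both of which tend to ξ. If they are constant, their value fixes β and ξ, although a conjugate
  -- of `c` has one fixed point only. If they are pairwise distinct, they collapse with attracting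
  -- and exceptional points ξ and β, in one order or the other.
  obtain ⟨φ, hφ, h | h⟩ :=
    exists_subsequence_const_or_injective (fun n => g n * c * (g n)⁻¹)
  · obtain ⟨h, hh⟩ := h
    have hgc : ∀ n (x : M), g (φ n) • c • x = h • g (φ n) • x := fun n x => by
      simp only [smul_smul, ← hh n]; group
    have hfix' : ∀ y : M, h • y = y → y = g (φ 0) • p := by
      intro y hy
      rw [← hfix ((g (φ 0))⁻¹ • y), smul_inv_smul]
      apply smul_left_cancel (g (φ 0))
      rw [hgc, smul_inv_smul, hy]
    obtain ⟨z, hz⟩ := (Set.finite_singleton p).exists_notMem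
    have hcz : c • z ≠ p := fun e => hz (smul_left_cancel c (e.trans hcp.symm))
    have hcol' := hcol.comp hφ.tendsto_atTop
    have t1 := (hcol'.tendsto_const hz).const_smul h
    have t2 := hcol'.tendsto_const hcz
    simp only [Function.comp_apply, hgc] at t1 t2
    have t3 := hβ.comp hφ.tendsto_atTop
    have t4 := t3.const_smul h
    simp only [Function.comp_def, ← hgc, hcp] at t3 t4
    exact hne ((hfix' β (tendsto_nhds_unique t4 t3)).trans
      (hfix' ξ (tendsto_nhds_unique t1 t2)).symm)
  · obtain ⟨σ, hσ, ζ, ω, hcon⟩ := hG.exists_collapses h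
    have ht := hφ.tendsto_atTop.comp hσ.tendsto_atTop
    replace hcol := hcol.comp ht
    replace hβ := hβ.comp ht
    have hcon' : Collapses (fun n => (g ∘ φ ∘ σ) n * c * ((g ∘ φ ∘ σ) n)⁻¹) ζ ω := hcon
    set f := g ∘ φ ∘ σ
    change Tendsto (fun n => f n • p) atTop (𝓝 β) at hβ
    clear_value f
    clear hcon
    obtain ⟨z, hz⟩ := (Set.finite_singleton p).exists_notMem
    have hcz : c • z ≠ p := fun e => hz (smul_left_cancel c (e.trans hcp.symm))
    have hβ' : β ≠ ω → β = ζ := fun h => by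
      have := hcon'.tendsto hβ h
      simp only [smul_smul, inv_mul_cancel_right] at this
      simp only [mul_smul, hcp] at this
      exact tendsto_nhds_unique hβ this
    have hξ' : ξ ≠ ω → ξ = ζ := fun h => by
      have := hcon'.tendsto (hcol.tendsto_const hz) h
      simp only [smul_smul, inv_mul_cancel_right] at this
      simp only [mul_smul] at this
      exact tendsto_nhds_unique (hcol.tendsto_const hcz) this
    by_cases hω : β = ω
    · subst hω
      obtain rfl := hξ' (Ne.symm hne)
      exact not_collapses_conj_of_parabolic hc hcol hβ hne hcon'
    · obtain rfl := hβ' hω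
      have hω' : ξ = ω := by
        by_contra h
        exact hne (hξ' h).symm
      subst hω'
      -- Inverting the conjugates exchanges attracting and exceptional points and replaces `c` by
      -- `c⁻¹`.
      refine not_collapses_conj_of_parabolic (c := c⁻¹) (k := k) ?_ hcol hβ hne ?_
      · simpa using hc.inv
      · simpa [mul_assoc] using hcon'.inv

/-- If translates of the pair of fixed points of a loxodromic element converge to a pair of distinct
points, then infinitely many of them agree. -/
theorem exists_frequently_smul_pair_eq [Countable G] [CompactSpace M] [T2Space M]
    [Infinite M] [ContinuousConstSMul G M]
    (hG : IsConvergenceAction G M) {c : G} {a b : M} (hca : c • a = a) (hcb : c • b = b)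
    (hab : a ≠ b) {k : ℕ → ℕ} (hc : Collapses (fun n => c ^ k n) a b) {g : ℕ → G} {α β : M}
    (hα : Tendsto (fun n => g n • a) atTop (𝓝 α)) (hβ : Tendsto (fun n => g n • b) atTop (𝓝 β))
    (hαβ : α ≠ β) : ∃ h : G, ∃ᶠ n in atTop, g n • a = h • a ∧ g n • b = h • b := by
  obtain ⟨z, hz⟩ := (Set.toFinite {a, b}).exists_notMem
  simp only [Set.mem_insert_iff, Set.mem_singleton_iff, not_or] at hz
  obtain ⟨hza, hzb⟩ := hz
  obtain ⟨U, V, hU, hV, hαU, hβV, hUV⟩ := t2_separation hαβ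
  have hUV' : ∀ x ∈ U, x ∉ V := fun x hx hx' => hUV.le_bot ⟨hx, hx'⟩
  -- For large `m`, `g n` sends `c ^ (-k m) • z` into `V` and `c ^ k m • z` into `U`; somewhere
  -- between these exponents the orbit leaves `V`.
  have hswitch : ∀ᶠ n in atTop, ∃ j : ℤ, g n • c ^ j • z ∈ V ∧ g n • c ^ (j + 1) • z ∉ V := by
    filter_upwards [hα (hU.mem_nhds hαU), hβ (hV.mem_nhds hβV)] with n h1 h2
    have h3 := ((hc.tendsto_const hzb).const_smul (g n)).eventually_mem (hU.mem_nhds h1)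
    have h4 := ((hc.inv.tendsto_const hza).const_smul (g n)).eventually_mem (hV.mem_nhds h2)
    obtain ⟨m, h3, h4⟩ := (h3.and h4).exists
    by_contra! hcon
    have hle : (-(k m : ℤ)) ≤ k m := by omega
    have : g n • c ^ (k m : ℤ) • z ∈ V := by
      refine Int.leInduction (motive := fun j _ => g n • c ^ j • z ∈ V) ?_
        (fun j _ => hcon j) _ hle
      simpa using h4
    rw [zpow_natCast] at this
    exact hUV' _ h3 this
  have hall : ∀ n, ∃ j : ℤ, (∃ j : ℤ, g n • c ^ j • z ∈ V ∧ g n • c ^ (j + 1) • z ∉ V) →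
      g n • c ^ j • z ∈ V ∧ g n • c ^ (j + 1) • z ∉ V := fun n => by
    by_cases h : ∃ j : ℤ, g n • c ^ j • z ∈ V ∧ g n • c ^ (j + 1) • z ∉ V
    · exact ⟨h.choose, fun _ => h.choose_spec⟩
    · exact ⟨0, fun h' => (h h').elim⟩
  choose j hj using hall
  replace hswitch := hswitch.mono fun n hn => hj n hn
  -- Powers of `c` do not affect the translates of `a` and `b`, so `g n` may be normalized to have
  -- its switch at exponent zero.
  have ha : ∀ n, (g n * c ^ j n) • a = g n • a := fun n => by
    rw [mul_smul, zpow_smul_of_smul_eq hca]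
  have hb : ∀ n, (g n * c ^ j n) • b = g n • b := fun n => by
    rw [mul_smul, zpow_smul_of_smul_eq hcb]
  obtain ⟨φ, hφ, ⟨h, hh⟩ | hinj⟩ := exists_subsequence_const_or_injective fun n => g n * c ^ j n
  · refine ⟨h, frequently_atTop.2 fun N => ⟨φ N, hφ.id_le N, ?_⟩⟩
    rw [← ha, ← hb, hh]
    exact ⟨rfl, rfl⟩
  -- A collapsing subsequence would have `a` or `b` as its exceptional point, since α ≠ β. In the
  -- first case `c • z` is attracted to β, in the second `z` is attracted to α; each contradicts the
  -- switch.
  · exfalso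
    obtain ⟨σ, hσ, ξ, η, hcol⟩ := hG.exists_collapses hinj
    have ht := hφ.tendsto_atTop.comp hσ.tendsto_atTop
    have tα := hα.comp ht
    have tβ := hβ.comp ht
    have hs := ht.eventually hswitch
    simp only [Function.comp_def, ← ha] at tα
    simp only [Function.comp_def, ← hb] at tβ
    by_cases hη : a = η
    · subst hη
      obtain rfl := tendsto_nhds_unique tβ (hcol.tendsto_const (Ne.symm hab))
      have hcz : c • z ≠ a := fun e => hza (smul_left_cancel c (e.trans hca.symm))
      have h1 := (hcol.tendsto_const hcz).eventually_mem (hV.mem_nhds hβV)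
      obtain ⟨n, h1, h2⟩ := (h1.and hs).exists
      apply h2.2
      rw [zpow_add_one, mul_smul, smul_smul]
      exact h1
    · obtain rfl := tendsto_nhds_unique tα (hcol.tendsto_const hη)
      by_cases hη' : b = η
      · subst hη'
        have h1 := (hcol.tendsto_const hzb).eventually_mem (hU.mem_nhds hαU)
        obtain ⟨n, h1, h2⟩ := (h1.and hs).exists
        refine hUV' _ h1 ?_
        change (g _ * c ^ j _) • z ∈ V
        rw [mul_smul]
        exact h2.1
      · exact hαβ (tendsto_nhds_unique (hcol.tendsto_const hη') tβ)

end FixedPoints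

/-! ### Quotients of compact metrizable spaces -/

section Quotient

variable {X : Type*} [TopologicalSpace X] [CompactSpace X] (s : Setoid X)

/-- The saturation of a closed set is the projection, along a compact factor, of a closed part of
the relation. -/
theorem isClosedMap_quotient_mk_of_isClosed (hs : IsClosed {q : X × X | s q.1 q.2}) :
    IsClosedMap (Quotient.mk s) := by
  intro C hC
  rw [← isQuotientMap_quotient_mk'.isClosed_preimage]
  have h1 : (Quotient.mk s) ⁻¹' (Quotient.mk s '' C) =
      Prod.snd '' ({q : X × X | s q.1 q.2} ∩ Prod.fst ⁻¹' C) := by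
    ext x
    constructor
    · rintro ⟨y, hy, hyx⟩
      exact ⟨(y, x), ⟨Quotient.exact hyx, hy⟩, rfl⟩
    · rintro ⟨⟨y, x⟩, ⟨h, hy⟩, rfl⟩
      exact ⟨y, hy, Quotient.sound h⟩
  exact h1 ▸ isClosedMap_snd_of_compactSpace _ (hs.inter (hC.preimage continuous_fst))

theorem t2Space_quotient_of_isClosed [T2Space X] (hs : IsClosed {q : X × X | s q.1 q.2}) :
    T2Space (Quotient s) := by
  have hmap := isClosedMap_quotient_mk_of_isClosed s hs
  have hfib : ∀ y : Quotient s, IsClosed (Quotient.mk s ⁻¹' {y}) := by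
    intro y
    obtain ⟨x, rfl⟩ := Quotient.exists_rep y
    refine IsClosed.preimage continuous_quotient_mk' ?_
    have := hmap _ (isClosed_singleton (x := x))
    rwa [Set.image_singleton] at this
  refine ⟨fun y y' hne => ?_⟩
  obtain ⟨U, V, hU, hV, hyU, hyV, hUV⟩ := SeparatedNhds.of_isCompact_isCompact
    (hfib y).isCompact (hfib y').isCompact (Set.disjoint_left.2 fun x hx hx' =>
      hne ((Set.mem_singleton_iff.1 hx).symm.trans hx'))
  refine ⟨(Quotient.mk s '' Uᶜ)ᶜ, (Quotient.mk s '' Vᶜ)ᶜ, (hmap _ hU.isClosed_compl).isOpen_compl,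
    (hmap _ hV.isClosed_compl).isOpen_compl, ?_, ?_, ?_⟩
  · rintro ⟨x, hx, rfl⟩
    exact hx (hyU rfl)
  · rintro ⟨x, hx, rfl⟩
    exact hx (hyV rfl)
  · refine Set.disjoint_left.2 fun z hz hz' => ?_
    obtain ⟨x, rfl⟩ := Quotient.exists_rep z
    have h1 : x ∈ U := by by_contra h; exact hz ⟨x, h, rfl⟩
    have h2 : x ∈ V := by by_contra h; exact hz' ⟨x, h, rfl⟩
    exact hUV.le_bot ⟨h1, h2⟩

/-- Fibres are compact, so a finite union of basic open sets fits between a fibre and any open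
preimage containing it. Since the quotient map is closed, the points whose whole fibre lies in such
a union form an open set, and these sets form a countable basis. -/
theorem secondCountableTopology_quotient_of_isClosed [T2Space X] [SecondCountableTopology X]
    (hs : IsClosed {q : X × X | s q.1 q.2}) : SecondCountableTopology (Quotient s) := by
  have hmap := isClosedMap_quotient_mk_of_isClosed s hs
  have := t2Space_quotient_of_isClosed s hs
  let B := TopologicalSpace.countableBasis X
  have hB := TopologicalSpace.isBasis_countableBasis X
  let W : Set (Set X) → Set (Quotient s) := fun F => (Quotient.mk s '' (⋃₀ F)ᶜ)ᶜ
  have hbasis : TopologicalSpace.IsTopologicalBasis (W '' {F | F.Finite ∧ F ⊆ B}) := by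
    refine TopologicalSpace.isTopologicalBasis_of_isOpen_of_nhds ?_ ?_
    · rintro _ ⟨F, ⟨-, hF⟩, rfl⟩
      exact (hmap _ (isOpen_sUnion fun u hu => hB.isOpen (hF hu)).isClosed_compl).isOpen_compl
    · intro y O hy hO
      have hO' := hO.preimage (continuous_quotient_mk' (s := s))
      have hK : IsCompact (Quotient.mk s ⁻¹' {y}) :=
        ((isClosed_singleton (x := y)).preimage continuous_quotient_mk').isCompact
      have hch : ∀ x ∈ Quotient.mk s ⁻¹' {y}, ∃ b ∈ B, x ∈ b ∧ b ⊆ Quotient.mk s ⁻¹' O := by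
        intro x hx
        refine hB.exists_subset_of_mem_open ?_ hO'
        rw [Set.mem_preimage] at hx ⊢
        exact (Set.mem_singleton_iff.1 hx) ▸ hy
      choose! b hbB hxb hbO using hch
      obtain ⟨t, ht, htc⟩ := hK.elim_nhds_subcover b fun x hx =>
        (hB.isOpen (hbB x hx)).mem_nhds (hxb x hx)
      refine ⟨W (b '' t), ⟨_, ⟨t.finite_toSet.image b, ?_⟩, rfl⟩, ?_, ?_⟩
      · rintro _ ⟨x, hx, rfl⟩
        exact hbB x (ht x hx)
      · rintro ⟨x, hx, hxy⟩
        refine hx ?_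
        have := htc (show x ∈ Quotient.mk s ⁻¹' {y} from hxy)
        rw [Set.sUnion_image]
        exact this
      · intro z hz
        obtain ⟨x, rfl⟩ := Quotient.exists_rep z
        by_contra hzO
        refine hz ⟨x, ?_, rfl⟩
        rintro ⟨_, ⟨x', hx', rfl⟩, hxx⟩
        exact hzO (hbO x' (ht x' hx') hxx)
  refine hbasis.secondCountableTopology (Set.Countable.image ?_ W)
  exact Set.countable_ofPred_finite_subset (TopologicalSpace.countable_countableBasis X)

end Quotient

/-! ### Equivariant images of convergence actions -/

section Image

variable {Λ M M' : Type*} [Group Λ] [TopologicalSpace M] [MulAction Λ M]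
  [TopologicalSpace M'] [MulAction Λ M']

theorem Collapses.image [CompactSpace M] [T2Space M] [CompactSpace M'] [T2Space M']
    {π : M → M'} (hπ : Continuous π) (hsurj : Function.Surjective π)
    (hequiv : ∀ (g : Λ) x, π (g • x) = g • π x) {γ : ℕ → Λ} {ξ η : M} (h : Collapses γ ξ η) :
    Collapses γ (π ξ) (π η) := by
  rw [collapses_iff_compact] at h ⊢
  intro K hK hη U hU
  filter_upwards [h (π ⁻¹' K) (hK.isClosed.preimage hπ).isCompact hη _ (hπ.continuousAt hU)]
    with n hn x hx
  obtain ⟨x, rfl⟩ := hsurj x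
  rw [← hequiv]
  exact hn x hx

theorem IsConvergenceAction.image [CompactSpace M] [T2Space M] [CompactSpace M'] [T2Space M']
    {π : M → M'} (hπ : Continuous π) (hsurj : Function.Surjective π)
    (hequiv : ∀ (g : Λ) x, π (g • x) = g • π x) (h : IsConvergenceAction Λ M) :
    IsConvergenceAction Λ M' := by
  rw [isConvergenceAction_iff] at h ⊢
  intro γ hγ
  obtain ⟨σ, hσ, ξ, η, hc⟩ := h γ hγ
  exact ⟨σ, hσ, _, _, hc.image hπ hsurj hequiv⟩

/-- A collapsing sequence downstairs has subsequences collapsing upstairs. Uniqueness of attracting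
points, for which `M'` must be infinite, matches the two limits. -/
theorem IsNonconical.image [CompactSpace M] [T2Space M] [CompactSpace M'] [T2Space M'] [Infinite M']
    {π : M → M'} (hπ : Continuous π) (hsurj : Function.Surjective π)
    (hequiv : ∀ (g : Λ) x, π (g • x) = g • π x) (h : IsConvergenceAction Λ M) {p : M}
    (hp : IsNonconical Λ p) : IsNonconical Λ (π p) := by
  intro γ ξ' η' hγ hcol
  refine tendsto_of_subseq_tendsto fun ns hns => ?_
  obtain ⟨φ, hφ, hφ'⟩ := strictMono_subseq_of_tendsto_atTop hns
  obtain ⟨σ, hσ, ξ, η, hc⟩ := h.exists_collapses (hγ.comp hφ'.injective)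
  refine ⟨φ ∘ σ, ?_⟩
  have h1 := hp _ _ _ ((hγ.comp hφ'.injective).comp hσ.injective) hc
  have h2 := (hc.image hπ hsurj hequiv).eq_left
    (hcol.comp (hφ'.tendsto_atTop.comp hσ.tendsto_atTop))
  have h3 := (hπ.tendsto ξ).comp h1
  rw [h2] at h3
  simpa only [Function.comp_def, hequiv] using h3

end Image

/-- A convergence action of `Λ` by homeomorphisms on a non-empty compact metrizable space, for which
the group `G` mapping to `Λ` preserves no finite non-empty set. -/
structure IsWildAction {G Λ : Type*} [Group G] [Group Λ] (j : G →* Λ) (M : Type*)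
    [TopologicalSpace M] [MulAction Λ M] : Prop where
  compact : CompactSpace M
  metrizable : TopologicalSpace.MetrizableSpace M
  continuous : ContinuousConstSMul Λ M
  convergence : IsConvergenceAction Λ M
  nonempty : Nonempty M
  not_invariant : ∀ F : Set M, F.Finite → F.Nonempty → ∃ g : G, ∃ x ∈ F, j g • x ∉ F

theorem IsWildAction.infinite {G Λ : Type*} [Group G] [Group Λ] {j : G →* Λ} {M : Type*}
    [TopologicalSpace M] [MulAction Λ M] (h : IsWildAction j M) : Infinite M := by
  by_contra hM
  rw [not_infinite_iff_finite] at hM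
  have := h.nonempty
  obtain ⟨g, x, -, hx⟩ := h.not_invariant Set.univ Set.finite_univ Set.univ_nonempty
  exact hx (Set.mem_univ _)

theorem eq_of_tendsto_of_frequently_eq {X : Type*} [TopologicalSpace X] [T1Space X] {u : ℕ → X}
    {x y : X} (h : Tendsto u atTop (𝓝 x)) (hy : ∃ᶠ n in atTop, u n = y) : x = y := by
  by_contra hne
  obtain ⟨n, h1, h2⟩ := (hy.and_eventually
    (h.eventually_mem (isOpen_compl_singleton.mem_nhds hne))).exists
  exact h2 h1

/-! ### Pinching the translates of a loxodromic pair -/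

section Loxodromic

variable {Λ M : Type*} [Group Λ] [Countable Λ] [TopologicalSpace M]
  [MulAction Λ M] [CompactSpace M] [T2Space M] [Infinite M]
  [ContinuousConstSMul Λ M]

/-- Otherwise the pairs `((c ^ k n)⁻¹ * h) • (a, b)` would approach `(a, b)` without reaching it:
their first entry is constantly `a`, and their second tends to `b` because `h • b ≠ a`. Discreteness
of translates forces equality for some `n`. -/
theorem smul_eq_right_of_loxodromic (hΛ : IsConvergenceAction Λ M) {c : Λ} {a b : M}
    (hca : c • a = a) (hcb : c • b = b) (hab : a ≠ b) {k : ℕ → ℕ}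
    (hc : Collapses (fun n => c ^ k n) a b) {h : Λ} (ha : h • a = a) : h • b = b := by
  have hy : h • b ≠ a := fun e => hab (smul_left_cancel h (ha.trans e.symm))
  have hfix : ∀ n, (c ^ k n)⁻¹ • a = a := fun n => by
    rw [inv_smul_eq_iff, ← zpow_natCast, zpow_smul_of_smul_eq hca]
  have hfix' : ∀ n, c ^ k n • b = b := fun n => by
    rw [← zpow_natCast, zpow_smul_of_smul_eq hcb]
  have tb : Tendsto (fun n => ((c ^ k n)⁻¹ * h) • b) atTop (𝓝 b) := by
    simpa only [mul_smul] using hc.inv.tendsto_const hy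
  have ta : Tendsto (fun n => ((c ^ k n)⁻¹ * h) • a) atTop (𝓝 a) := by
    simp only [mul_smul, ha, hfix, tendsto_const_nhds]
  obtain ⟨h', hh'⟩ := exists_frequently_smul_pair_eq hΛ hca hcb hab hc ta tb hab
  obtain ⟨n, -, hn⟩ := hh'.exists
  rw [← eq_of_tendsto_of_frequently_eq tb (hh'.mono fun n hn => hn.2), mul_smul, inv_smul_eq_iff,
    hfix'] at hn
  exact hn

/-- The same argument, with `c ^ k n * h` carrying the pair towards `(b, a)`. -/
theorem smul_eq_left_of_loxodromic (hΛ : IsConvergenceAction Λ M) {c : Λ} {a b : M}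
    (hca : c • a = a) (hcb : c • b = b) (hab : a ≠ b) {k : ℕ → ℕ}
    (hc : Collapses (fun n => c ^ k n) a b) {h : Λ} (ha : h • a = b) : h • b = a := by
  have hy : h • b ≠ b := fun e => hab (smul_left_cancel h (ha.trans e.symm))
  have hfix : ∀ n, c ^ k n • a = a := fun n => by
    rw [← zpow_natCast, zpow_smul_of_smul_eq hca]
  have hfix' : ∀ n, c ^ k n • b = b := fun n => by
    rw [← zpow_natCast, zpow_smul_of_smul_eq hcb]
  have tb : Tendsto (fun n => (c ^ k n * h) • b) atTop (𝓝 a) := by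
    simpa only [mul_smul] using hc.tendsto_const hy
  have ta : Tendsto (fun n => (c ^ k n * h) • a) atTop (𝓝 b) := by
    simp only [mul_smul, ha, hfix', tendsto_const_nhds]
  obtain ⟨h', hh'⟩ := exists_frequently_smul_pair_eq hΛ hca hcb hab hc ta tb hab.symm
  obtain ⟨n, -, hn⟩ := hh'.exists
  rw [← eq_of_tendsto_of_frequently_eq tb (hh'.mono fun n hn => hn.2), mul_smul] at hn
  exact smul_left_cancel _ (hn.trans (hfix n).symm)

/-- The equivalence relation which identifies the two points of each translate of `{a, b}`. -/
theorem exists_pinching_setoid [FirstCountableTopology M] (hΛ : IsConvergenceAction Λ M) {c : Λ}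
    {a b : M} (hca : c • a = a) (hcb : c • b = b) (hab : a ≠ b) {k : ℕ → ℕ}
    (hc : Collapses (fun n => c ^ k n) a b) :
    ∃ s : Setoid M,
      (∀ x y, s x y ↔ x = y ∨ ∃ g : Λ, x = g • a ∧ y = g • b ∨ x = g • b ∧ y = g • a) ∧
      (∀ x y z, s x y → s y z → x = y ∨ y = z ∨ x = z) ∧ IsClosed {q : M × M | s q.1 q.2} := by
  have hc' : Collapses (fun n => c⁻¹ ^ k n) b a := by simpa using hc.inv
  have hca' : c⁻¹ • a = a := by rw [inv_smul_eq_iff, hca]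
  have hcb' : c⁻¹ • b = b := by rw [inv_smul_eq_iff, hcb]
  have tr : ∀ g g' : Λ, ∀ {x y : M}, g • x = g' • y ↔ (g⁻¹ * g') • y = x := fun g g' x y => by
    rw [mul_smul, inv_smul_eq_iff, eq_comm]
  let r : M → M → Prop := fun x y =>
    x = y ∨ ∃ g : Λ, x = g • a ∧ y = g • b ∨ x = g • b ∧ y = g • a
  -- Translates of `{a, b}` that share a point coincide, so classes have at most two points. The
  -- four cases are the two preceding lemmas for `c` and, with `a` and `b` exchanged, for `c⁻¹`.
  have htr : ∀ x y z, r x y → r y z → x = y ∨ y = z ∨ x = z := by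
    rintro x y z (h | ⟨g, hg⟩) (h' | ⟨g', hg'⟩)
    · exact Or.inl h
    · exact Or.inl h
    · exact Or.inr (Or.inl h')
    · right; right
      rcases hg with ⟨rfl, rfl⟩ | ⟨rfl, rfl⟩ <;> rcases hg' with ⟨h, rfl⟩ | ⟨h, rfl⟩ <;>
        rw [tr] at h ⊢
      · exact smul_eq_left_of_loxodromic hΛ hca hcb hab hc h
      · exact smul_eq_right_of_loxodromic hΛ hcb' hca' hab.symm hc' h
      · exact smul_eq_right_of_loxodromic hΛ hca hcb hab hc h
      · exact smul_eq_left_of_loxodromic hΛ hcb' hca' hab.symm hc' h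
  let s : Setoid M :=
    { r := r
      iseqv := by
        refine ⟨fun x => Or.inl rfl, ?_, ?_⟩
        · rintro x y (rfl | ⟨g, h | h⟩)
          · exact Or.inl rfl
          · exact Or.inr ⟨g, Or.inr ⟨h.2, h.1⟩⟩
          · exact Or.inr ⟨g, Or.inl ⟨h.2, h.1⟩⟩
        · intro x y z hxy hyz
          rcases htr x y z hxy hyz with rfl | rfl | rfl
          · exact hyz
          · exact hxy
          · exact Or.inl rfl }
  refine ⟨s, fun x y => Iff.rfl, htr, ?_⟩
  -- A limit of translated pairs off the diagonal is itself a translate, since infinitely many of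
  -- the pairs agree with one translate.
  have hR : IsClosed {q : M × M | q.1 = q.2 ∨ ∃ g : Λ, q.1 = g • a ∧ q.2 = g • b} := by
    refine IsSeqClosed.isClosed fun u q hu hq => ?_
    by_cases hne : q.1 = q.2
    · exact Or.inl hne
    · right
      have h1 := (continuous_fst.tendsto q).comp hq
      have h2 := (continuous_snd.tendsto q).comp hq
      have hall : ∀ n, ∃ g : Λ, (u n).1 ≠ (u n).2 → (u n).1 = g • a ∧ (u n).2 = g • b := by
        intro n
        rcases hu n with h | ⟨g, h⟩
        · exact ⟨1, fun h' => (h' h).elim⟩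
        · exact ⟨g, fun _ => h⟩
      choose g hg using hall
      have hev : ∀ᶠ n in atTop, (u n).1 ≠ (u n).2 :=
        hq.eventually (isClosed_diagonal.isOpen_compl.mem_nhds hne)
      replace hev := hev.mono fun n hn => hg n hn
      replace h1 := h1.congr' (hev.mono fun n hn => hn.1)
      replace h2 := h2.congr' (hev.mono fun n hn => hn.2)
      obtain ⟨h, hh⟩ := exists_frequently_smul_pair_eq hΛ hca hcb hab hc h1 h2 hne
      exact ⟨h, eq_of_tendsto_of_frequently_eq h1 (hh.mono fun n hn => hn.1),
        eq_of_tendsto_of_frequently_eq h2 (hh.mono fun n hn => hn.2)⟩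
  convert hR.union (hR.preimage continuous_swap) using 1
  ext ⟨x, y⟩
  change (x = y ∨ ∃ g : Λ, x = g • a ∧ y = g • b ∨ x = g • b ∧ y = g • a) ↔
    (x = y ∨ ∃ g : Λ, x = g • a ∧ y = g • b) ∨ (y = x ∨ ∃ g : Λ, y = g • a ∧ x = g • b)
  constructor
  · rintro (h | ⟨g, h | h⟩)
    · exact Or.inl (Or.inl h)
    · exact Or.inl (Or.inr ⟨g, h⟩)
    · exact Or.inr (Or.inr ⟨g, h.2, h.1⟩)
  · rintro ((h | ⟨g, h⟩) | h | ⟨g, h⟩)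
    · exact Or.inl h
    · exact Or.inr ⟨g, Or.inl h⟩
    · exact Or.inl h.symm
    · exact Or.inr ⟨g, Or.inr ⟨h.2, h.1⟩⟩

end Loxodromic

/-- The action on the quotient by an invariant equivalence relation. -/
abbrev quotientMulAction {Λ M : Type*} [Group Λ] [MulAction Λ M] (s : Setoid M)
    (hs : ∀ (g : Λ) x y, s x y → s (g • x) (g • y)) : MulAction Λ (Quotient s) where
  smul g := Quotient.map (g • ·) (hs g)
  one_smul q := by
    induction q using Quotient.inductionOn with
    | h x => exact congrArg (Quotient.mk s) (one_smul Λ x)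
  mul_smul g h q := by
    induction q using Quotient.inductionOn with
    | h x => exact congrArg (Quotient.mk s) (mul_smul g h x)

/-- After passing to an equivariant quotient, a given element of infinite order fixes a point which
is not conical; points which were already not conical keep this property. -/
theorem IsWildAction.exists_isNonconical {G Λ : Type*} [Group G] [Group Λ]
    [Countable Λ] {j : G →* Λ} {M : Type} [TopologicalSpace M]
    [MulAction Λ M] (h : IsWildAction j M) {c : Λ} (hcinf : ¬ IsOfFinOrder c) :
    ∃ (M' : Type) (_ : TopologicalSpace M') (_ : MulAction Λ M'), IsWildAction j M' ∧
      (∃ p : M', c • p = p ∧ IsNonconical Λ p) ∧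
      ∀ p : M, IsNonconical Λ p →
        ∃ p' : M', IsNonconical Λ p' ∧ ∀ g : Λ, g • p = p → g • p' = p' := by
  obtain ⟨h1, h2, h3, h4, h5, h6⟩ := id h
  have hinf := h.infinite
  obtain ⟨k, hk, a, b, hc⟩ :=
    h4.exists_collapses (injective_pow_iff_not_isOfFinOrder.2 hcinf)
  change Collapses (fun n => c ^ k n) a b at hc
  -- Powers of `c` commute with `c`, so uniqueness of the attracting and exceptional points makes
  -- `c` fix both.
  have hconj : Collapses (fun n => c * c ^ k n * c⁻¹) (c • a) (c⁻¹⁻¹ • b) :=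
    (hc.mul_left c).mul_right c⁻¹
  have hsimp : ∀ n : ℕ, c * c ^ n * c⁻¹ = c ^ n := fun n => by
    rw [← pow_succ', pow_succ, mul_inv_cancel_right]
  simp only [hsimp, inv_inv] at hconj
  have hca := hconj.eq_left hc
  have hcb := hconj.eq_right hc
  by_cases hab : a = b
  · subst hab
    exact ⟨M, _, _, h, ⟨a, hca, isNonconical_of_parabolic h4 hca hc⟩,
      fun p hp => ⟨p, hp, fun _ => id⟩⟩
  obtain ⟨s, hs, htr, hclosed⟩ := exists_pinching_setoid h4 hca hcb hab hc
  have hinv : ∀ (g : Λ) x y, s x y → s (g • x) (g • y) := by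
    intro g x y hxy
    rw [hs] at hxy ⊢
    rcases hxy with rfl | ⟨g', ⟨rfl, rfl⟩ | ⟨rfl, rfl⟩⟩
    · exact Or.inl rfl
    · exact Or.inr ⟨g * g', Or.inl ⟨(mul_smul _ _ _).symm, (mul_smul _ _ _).symm⟩⟩
    · exact Or.inr ⟨g * g', Or.inr ⟨(mul_smul _ _ _).symm, (mul_smul _ _ _).symm⟩⟩
  let act := quotientMulAction s hinv
  have hπ : Continuous (Quotient.mk s) := continuous_quotient_mk'
  have hsurj : Function.Surjective (Quotient.mk s) := Quotient.mk_surjective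
  have hequiv : ∀ (g : Λ) x, Quotient.mk s (g • x) = g • Quotient.mk s x := fun _ _ => rfl
  have hT2 := t2Space_quotient_of_isClosed s hclosed
  have hSC := secondCountableTopology_quotient_of_isClosed s hclosed
  have hfib : ∀ x : M, {y | Quotient.mk s y = Quotient.mk s x}.Finite := by
    intro x
    by_cases hx : ∃ y, y ≠ x ∧ s y x
    · obtain ⟨y, hyx, hy⟩ := hx
      refine (Set.toFinite {x, y}).subset fun z hz => ?_
      rcases htr y x z hy (s.symm (Quotient.exact hz)) with h | h | h
      · exact (hyx h).elim
      · exact Or.inl h.symm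
      · exact Or.inr h.symm
    · refine (Set.finite_singleton x).subset fun z hz => ?_
      by_contra hzx
      exact hx ⟨z, hzx, Quotient.exact hz⟩
  have hwild : IsWildAction j (Quotient s) :=
    { compact := inferInstance
      metrizable := inferInstance
      continuous := ⟨fun g => (hπ.comp (continuous_const_smul g)).quotient_lift _⟩
      convergence := h4.image hπ hsurj hequiv
      nonempty := h5.map (Quotient.mk s)
      not_invariant := by
        intro F hF hF'
        obtain ⟨g, x, hx, hgx⟩ := h6 (Quotient.mk s ⁻¹' F) (by
          refine Set.Finite.preimage' hF fun q hq => ?_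
          obtain ⟨x, rfl⟩ := hsurj q
          exact hfib x) (hF'.preimage hsurj)
        exact ⟨g, _, hx, hgx⟩ }
  have hinf' := hwild.infinite
  refine ⟨Quotient s, inferInstance, act, hwild, ⟨Quotient.mk s a, ?_, ?_⟩, fun p hp =>
    ⟨Quotient.mk s p, hp.image hπ hsurj hequiv h4, fun g hg => by rw [← hequiv, hg]⟩⟩
  · rw [← hequiv, hca]
  · intro γ ξ' η' hγ hcol
    refine tendsto_of_subseq_tendsto fun ns hns => ?_
    obtain ⟨φ, hφ, hφ'⟩ := strictMono_subseq_of_tendsto_atTop hns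
    obtain ⟨σ, hσ, ξ, η, hc1⟩ := h4.exists_collapses (hγ.comp hφ'.injective)
    have h2 := (hc1.image hπ hsurj hequiv).eq_left
      (hcol.comp (hφ'.tendsto_atTop.comp hσ.tendsto_atTop))
    refine ⟨φ ∘ σ, ?_⟩
    change Tendsto (fun n => Quotient.mk s ((γ ∘ (ns ∘ φ) ∘ σ) n • a)) _ _
    rw [← h2]
    -- The points `a` and `b` have the same translates downstairs, and at most one of them is
    -- exceptional upstairs; the other one is attracted to ξ.
    by_cases hη : a = η
    · have hb : b ≠ η := fun e => hab (hη.trans e.symm)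
      have h3 := (hπ.tendsto ξ).comp (hc1.tendsto_const hb)
      refine h3.congr fun n => Quotient.sound ((hs _ _).2 (Or.inr ⟨_, Or.inr ⟨rfl, rfl⟩⟩))
    · exact (hπ.tendsto ξ).comp (hc1.tendsto_const hη)

/-! ### Combination along a system of directions -/

/-- A system of directions for the subgroup `i : G → Λ`, with values in a `G`-space `M`. Think of a
tree on which `Λ` acts with `G` a vertex stabilizer: `d γ` is the direction, seen from the vertex
fixed by `G`, in which its translate by `γ` lies; elements of `short` move this vertex so little that
no translate lies strictly inbetween. -/
structure IsDirectionSystem {G Λ M : Type*} [Group G] [Group Λ] [MulAction G M] (i : G →* Λ)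
    (d : Λ → M) (short : Set Λ) : Prop where
  injective : Function.Injective i
  map_mul : ∀ g γ, γ ∉ i.range → d (i g * γ) = g • d γ
  mul_map : ∀ g γ, γ ∉ i.range → d (γ * i g) = d γ
  -- Different directions mean that the base vertex lies strictly between its translates by `x` and
  -- `y`; seen from the former, the latter and the base vertex then lie in the same direction.
  inv_mul : ∀ x y, x ∉ i.range → y ∉ i.range → d x ≠ d y →
    x⁻¹ * y ∉ short ∧ d (x⁻¹ * y) = d x⁻¹
  range_subset : (i.range : Set Λ) ⊆ short
  closure_short : Subgroup.closure short = ⊤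

namespace IsDirectionSystem

variable {G Λ M : Type*} [Group G] [Group Λ] [MulAction G M] {i : G →* Λ}
  {d : Λ → M} {short : Set Λ}

theorem congr {Λ' : Type*} [Group Λ'] (h : IsDirectionSystem i d short) (e : Λ' ≃* Λ) :
    IsDirectionSystem ((e.symm : Λ →* Λ').comp i) (d ∘ e) (e ⁻¹' short) := by
  have hr : ∀ γ, γ ∉ ((e.symm : Λ →* Λ').comp i).range → e γ ∉ i.range := by
    rintro γ hγ ⟨g, hg⟩
    exact hγ ⟨g, by simp [hg]⟩
  refine ⟨e.symm.injective.comp h.injective, ?_, ?_, ?_, ?_, ?_⟩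
  · intro g γ hγ
    simpa using h.map_mul g _ (hr γ hγ)
  · intro g γ hγ
    simpa using h.mul_map g _ (hr γ hγ)
  · intro x y hx hy hxy
    simpa using h.inv_mul _ _ (hr x hx) (hr y hy) hxy
  · rintro _ ⟨g, rfl⟩
    simpa using h.range_subset ⟨g, rfl⟩
  · have := (MonoidHom.map_closure (e.symm : Λ →* Λ') short).symm
    rw [h.closure_short] at this
    have h2 : (e.symm : Λ →* Λ') '' short = e ⁻¹' short := e.symm.toEquiv.image_eq_preimage_symm _
    rw [← h2, this]
    exact Subgroup.map_top_of_surjective _ e.symm.surjective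

/-- Only finitely many vertices lie strictly between two given ones. -/
theorem exists_finite_between (h : IsDirectionSystem i d short) (δ : Λ) :
    ∃ T : Set Λ, T.Finite ∧ ∀ x, x⁻¹ ∉ i.range → x⁻¹ * δ ∉ i.range → d x⁻¹ ≠ d (x⁻¹ * δ) →
      ∃ t ∈ T, t⁻¹ * x ∈ i.range := by
  have hδ : δ ∈ Subgroup.closure short := h.closure_short ▸ Subgroup.mem_top δ
  induction hδ using Subgroup.closure_induction with
  | mem s hs =>
    refine ⟨∅, Set.finite_empty, fun x hx hxs hne => ?_⟩
    have := (h.inv_mul _ _ hx hxs hne).1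
    rw [inv_inv, mul_inv_cancel_left] at this
    exact (this hs).elim
  | one => exact ⟨∅, Set.finite_empty, fun x _ _ hne => by simp at hne⟩
  -- A vertex strictly between the base vertex and its translate by `δ * δ'` is the translate by
  -- `δ`, or separates it from the base vertex, or is `δ` times a vertex coming from `δ'`.
  | mul δ δ' _ _ ih ih' =>
    obtain ⟨T, hT, hT'⟩ := ih
    obtain ⟨S, hS, hS'⟩ := ih'
    refine ⟨insert δ (T ∪ (δ * ·) '' S), (hT.union (hS.image _)).insert _, fun x hx hxδ hne => ?_⟩
    by_cases hm : x⁻¹ * δ ∈ i.range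
    · refine ⟨δ, Or.inl rfl, ?_⟩
      rw [← inv_mem_iff]
      simpa using hm
    by_cases h1 : d x⁻¹ = d (x⁻¹ * δ)
    · obtain ⟨t, ht, htx⟩ := hS' (δ⁻¹ * x) (by simpa using hm) (by simpa [mul_assoc] using hxδ)
        (by simpa [mul_assoc, ← h1] using hne)
      exact ⟨δ * t, Or.inr (Or.inr ⟨t, ht, rfl⟩), by simpa [mul_assoc] using htx⟩
    · obtain ⟨t, ht, htx⟩ := hT' x hx hm h1
      exact ⟨t, Or.inr (Or.inl ht), htx⟩
  | inv δ _ ih =>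
    obtain ⟨T, hT, hT'⟩ := ih
    refine ⟨(δ⁻¹ * ·) '' T, hT.image _, fun x hx hxδ hne => ?_⟩
    obtain ⟨t, ht, htx⟩ := hT' (δ * x) (by simpa using hxδ) (by simpa using hx)
      (by simpa using hne.symm)
    exact ⟨_, ⟨t, ht, rfl⟩, by simpa [mul_assoc] using htx⟩

/-- If `γ n` moves the vertex `a` off every vertex, then the directions from `a` to the translates by
`(γ n)⁻¹` of any two vertices eventually agree. -/
theorem eventually_direction_eq (h : IsDirectionSystem i d short) {γ : ℕ → Λ} {a : Λ}
    (ha : ∀ c, ∀ᶠ n in atTop, c⁻¹ * (γ n * a) ∉ i.range) (δ δ' : Λ) :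
    ∀ᶠ n in atTop, d (a⁻¹ * (γ n)⁻¹ * δ) = d (a⁻¹ * (γ n)⁻¹ * δ') := by
  obtain ⟨T, hT, hT'⟩ := h.exists_finite_between (δ⁻¹ * δ')
  have h1 : ∀ᶠ n in atTop, ∀ t ∈ T, (δ * t)⁻¹ * (γ n * a) ∉ i.range :=
    (eventually_all_finite hT).2 fun t _ => ha (δ * t)
  filter_upwards [h1, ha δ, ha δ'] with n hn hn1 hn2
  by_contra hne
  have key : ∀ δ : Λ, δ⁻¹ * (γ n * a) ∉ i.range → a⁻¹ * (γ n)⁻¹ * δ ∉ i.range := fun δ hδ => by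
    rw [← inv_mem_iff]
    simpa [mul_assoc] using hδ
  obtain ⟨t, ht, htx⟩ := hT' (δ⁻¹ * (γ n * a)) (by simpa [mul_assoc] using key δ hn1)
    (by simpa [mul_assoc] using key δ' hn2) (by simpa [mul_assoc] using hne)
  exact hn t ht (by simpa [mul_assoc] using htx)

end IsDirectionSystem

/-- The space obtained by gluing translates of `M` along a system of directions: a point consists of
its projections to all the translates, any two of which are constrained by the directions. -/
def directionSpace {G Λ M : Type*} [Group G] [Group Λ] [MulAction G M] (i : G →* Λ)
    (d : Λ → M) : Set (Λ → M) :=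
  {f | (∀ a g, f (a * i g) = g⁻¹ • f a) ∧
    ∀ a b, a⁻¹ * b ∉ i.range → f a = d (a⁻¹ * b) ∨ f b = d (b⁻¹ * a)}

section DirectionSpace

variable {G Λ M : Type*} [Group G] [Group Λ] [MulAction G M] (i : G →* Λ) (d : Λ → M)

instance directionSpace.mulAction : MulAction Λ (directionSpace i d) where
  smul γ f := ⟨fun x => f.1 (γ⁻¹ * x), fun a g => by
    have := f.2.1 (γ⁻¹ * a) g
    rwa [mul_assoc] at this,
    fun a b hab => by
      have := f.2.2 (γ⁻¹ * a) (γ⁻¹ * b) (by simpa [mul_assoc] using hab)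
      simpa [mul_assoc] using this⟩
  one_smul f := Subtype.ext <| funext fun x => by
    change f.1 (1⁻¹ * x) = f.1 x
    rw [inv_one, one_mul]
  mul_smul γ γ' f := Subtype.ext <| funext fun x => by
    change f.1 ((γ * γ')⁻¹ * x) = f.1 (γ'⁻¹ * (γ⁻¹ * x))
    rw [mul_inv_rev, mul_assoc]

theorem directionSpace.smul_apply (γ : Λ) (f : directionSpace i d) (x : Λ) :
    (γ • f).1 x = f.1 (γ⁻¹ * x) := rfl

variable {i d}

theorem isClosed_directionSpace [TopologicalSpace M] [T2Space M] [ContinuousConstSMul G M] :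
    IsClosed (directionSpace i d) := by
  have h1 : IsClosed {f : Λ → M | ∀ a g, f (a * i g) = g⁻¹ • f a} := by
    simp only [Set.ofPred_forall]
    exact isClosed_iInter fun a => isClosed_iInter fun g =>
      isClosed_eq (continuous_apply _) ((continuous_apply a).const_smul _)
  have h2 : IsClosed {f : Λ → M |
      ∀ a b, a⁻¹ * b ∉ i.range → f a = d (a⁻¹ * b) ∨ f b = d (b⁻¹ * a)} := by
    simp only [Set.ofPred_forall]
    exact isClosed_iInter fun a => isClosed_iInter fun b => isClosed_iInter fun _ =>
      (isClosed_eq (continuous_apply a) continuous_const).union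
        (isClosed_eq (continuous_apply b) continuous_const)
  exact h1.inter h2

/-- Each point of `M` gives a point of the glued space. -/
theorem IsDirectionSystem.exists_mem_directionSpace {short : Set Λ}
    (h : IsDirectionSystem i d short) (m : M) : ∃ f : directionSpace i d, f.1 1 = m := by
  classical
  -- Away from the base vertex, every coordinate points back towards the base vertex.
  let f : Λ → M := fun b => if hb : b ∈ i.range then (hb.choose)⁻¹ • m else d b⁻¹
  have hf : ∀ g, f (i g) = g⁻¹ • m := by
    intro g
    have hb : i g ∈ i.range := ⟨g, rfl⟩
    simp only [f, dif_pos hb]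
    rw [h.injective hb.choose_spec]
  have hf' : ∀ b, b ∉ i.range → f b = d b⁻¹ := fun b hb => dif_neg hb
  refine ⟨⟨f, ?_, ?_⟩, by simpa using hf 1⟩
  · intro a g
    by_cases ha : a ∈ i.range
    · obtain ⟨g', rfl⟩ := ha
      rw [← _root_.map_mul, hf, hf, mul_inv_rev, mul_smul]
    · have ha' : a * i g ∉ i.range := fun hc =>
        ha ((Subgroup.mul_mem_cancel_right _ (MonoidHom.mem_range.2 ⟨g, rfl⟩)).1 hc)
      rw [hf' _ ha, hf' _ ha', mul_inv_rev, ← map_inv, h.map_mul _ _ (by rwa [inv_mem_iff])]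
  · intro a b hab
    have hba : b⁻¹ * a ∉ i.range := fun hc => hab (by rw [← inv_mem_iff]; simpa using hc)
    by_cases ha : a ∈ i.range
    · obtain ⟨g, rfl⟩ := ha
      have hb : b ∉ i.range := fun hb => hab (mul_mem (inv_mem ⟨g, rfl⟩) hb)
      right
      rw [hf' _ hb, h.mul_map _ _ (by rwa [inv_mem_iff])]
    · by_cases hb : b ∈ i.range
      · obtain ⟨g, rfl⟩ := hb
        left
        rw [hf' _ ha, h.mul_map _ _ (by rwa [inv_mem_iff])]
      -- If the directions differ, `a` lies between the base vertex and `b`, so from `b` the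
      -- direction of `a` is that of the base vertex.
      · by_cases hd : d (a⁻¹ * b) = d a⁻¹
        · left
          rw [hf' _ ha, hd]
        · right
          have := (h.inv_mul (a⁻¹ * b) a⁻¹ hab (by rwa [inv_mem_iff]) hd).2
          rw [hf' _ hb]
          simpa using this

end DirectionSpace

theorem Collapses.congr' {G M : Type*} [TopologicalSpace M] [SMul G M] {γ γ' : ℕ → G} {ξ η : M}
    (h : Collapses γ ξ η) (he : γ =ᶠ[atTop] γ') : Collapses γ' ξ η := by
  intro x hx
  have he' : ∀ᶠ n in atTop, γ n = γ' n := he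
  refine (h x hx).congr' ?_
  filter_upwards [he'.prod_inl (𝓝 x)] with q hq
  rw [hq]

/-- The defining property of nonconical points, for eventually injective sequences. -/
theorem IsNonconical.tendsto {G M : Type*} [Group G] [TopologicalSpace M] [MulAction G M] {p : M}
    (hp : IsNonconical G p) {γ : ℕ → G} {ξ η : M} {N : ℕ} (hγ : Set.InjOn γ (Set.Ici N))
    (h : Collapses γ ξ η) : Tendsto (fun n => γ n • p) atTop (𝓝 ξ) := by
  have hinj : Function.Injective fun n => γ (n + N) := fun m n e =>
    Nat.add_right_cancel (hγ (Set.mem_Ici.2 (N.le_add_left m)) (Set.mem_Ici.2 (N.le_add_left n)) e)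
  have := hp _ ξ η hinj (h.comp (φ := fun n => n + N) (tendsto_add_atTop_nat N))
  exact (tendsto_add_atTop_iff_nat (f := fun n => γ n • p) N).1 this

/-! ### The combination theorem -/

section Convergence

variable {G Λ M : Type*} [Group G] [Group Λ] [MulAction G M] {i : G →* Λ}
  {d : Λ → M} {short : Set Λ} [TopologicalSpace M] [T2Space M]

/-- A subsequence along which all the directions converge, and for which each vertex is either moved
off to infinity, or moved to some vertex by a sequence collapsing `M`. -/
theorem exists_subsequence_directions (i : G →* Λ) (d : Λ → M) [CompactSpace M]
    [FirstCountableTopology M] [Countable Λ] (hG : IsConvergenceAction G M)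
    {γ : ℕ → Λ} (hγ : Function.Injective γ) :
    ∃ φ : ℕ → ℕ, StrictMono φ ∧ ∀ a,
      (∃ x, Tendsto (fun n => d (a⁻¹ * (γ (φ n))⁻¹)) atTop (𝓝 x)) ∧
      (∃ x, Tendsto (fun n => d (a⁻¹ * γ (φ n))) atTop (𝓝 x)) ∧
      ((∀ c, ∀ᶠ n in atTop, c⁻¹ * (γ (φ n) * a) ∉ i.range) ∨
        ∃ (c : Λ) (g : ℕ → G) (ξ η : M), (∀ᶠ n in atTop, γ (φ n) * a = c * i (g n)) ∧
          Collapses g ξ η) := by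
  let P : Λ → Filter ℕ → Prop := fun a l =>
      (∃ x, Tendsto (fun n => d (a⁻¹ * (γ n)⁻¹)) l (𝓝 x)) ∧
      (∃ x, Tendsto (fun n => d (a⁻¹ * γ n)) l (𝓝 x)) ∧
      ((∀ c, ∀ᶠ n in l, c⁻¹ * (γ n * a) ∉ i.range) ∨
        ∃ (c : Λ) (g : ℕ → G) (ξ η : M), (∀ᶠ n in l, γ n * a = c * i (g n)) ∧
          ∀ x, x ≠ η → Tendsto (fun q : ℕ × M => g q.1 • q.2) (l ×ˢ 𝓝 x) (𝓝 ξ))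
  have hanti : ∀ a l l', l ≤ l' → P a l' → P a l := by
    rintro a l l' hl ⟨⟨x, hx⟩, ⟨y, hy⟩, hz⟩
    refine ⟨⟨x, hx.mono_left hl⟩, ⟨y, hy.mono_left hl⟩, hz.imp (fun h c => (h c).filter_mono hl) ?_⟩
    rintro ⟨c, g, ξ, η, h1, h2⟩
    exact ⟨c, g, ξ, η, h1.filter_mono hl,
      fun x hx => (h2 x hx).mono_left (Filter.prod_mono_left _ hl)⟩
  obtain ⟨φ, hφ, hP⟩ := exists_diagonal_subsequence P hanti (by
    intro a φ hφ
    obtain ⟨x, ψ, hψ, hx⟩ := CompactSpace.tendsto_subseq fun n => d (a⁻¹ * (γ (φ n))⁻¹)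
    obtain ⟨y, θ, hθ, hy⟩ := CompactSpace.tendsto_subseq fun n => d (a⁻¹ * γ (φ (ψ n)))
    have hx' := hx.comp hθ.tendsto_atTop
    have hτ := hφ.comp (hψ.comp hθ)
    by_cases hc : ∃ c, ∃ᶠ n in atTop, c⁻¹ * (γ (φ (ψ (θ n))) * a) ∈ i.range
    · obtain ⟨c, hc⟩ := hc
      obtain ⟨σ, hσ, hσ'⟩ := extraction_of_frequently_atTop hc
      have hg : ∀ n, ∃ g : G, c⁻¹ * (γ n * a) ∈ i.range → c⁻¹ * (γ n * a) = i g := fun n => by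
        by_cases hn : c⁻¹ * (γ n * a) ∈ i.range
        · obtain ⟨g, hg⟩ := hn
          exact ⟨g, fun _ => hg.symm⟩
        · exact ⟨1, fun h => (hn h).elim⟩
      choose g hg using hg
      have hg' := fun n => hg _ (hσ' n)
      have hinj : Function.Injective fun n => g (φ (ψ (θ (σ n)))) := by
        intro m n hmn
        have := (hg' m).trans ((congrArg i hmn).trans (hg' n).symm)
        exact (hτ.comp hσ).injective (hγ (mul_right_cancel (mul_left_cancel this)))
      obtain ⟨ρ, hρ, ξ, η, hcol⟩ := hG.exists_collapses hinj
      have ht := (hσ.comp hρ).tendsto_atTop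
      refine ⟨ψ ∘ θ ∘ σ ∘ ρ, hψ.comp (hθ.comp (hσ.comp hρ)), ⟨x, ?_⟩, ⟨y, ?_⟩, Or.inr
        ⟨c, g, ξ, η, ?_, ?_⟩⟩
      · exact tendsto_map'_iff.2 (hx'.comp ht)
      · exact tendsto_map'_iff.2 (hy.comp ht)
      · exact eventually_map.2 (Eventually.of_forall fun n => by
          rw [← mul_inv_cancel_left c (γ _ * a)]
          exact congrArg (c * ·) (hg' (ρ n)))
      · intro x hx
        rw [Filter.prod_map_left, tendsto_map'_iff]
        exact hcol x hx
    · push Not at hc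
      refine ⟨ψ ∘ θ, hψ.comp hθ, ⟨x, ?_⟩, ⟨y, ?_⟩, Or.inl fun c => ?_⟩
      · exact tendsto_map'_iff.2 hx'
      · exact tendsto_map'_iff.2 hy
      · exact eventually_map.2 (hc c))
  refine ⟨φ, hφ, fun a => ?_⟩
  obtain ⟨⟨x, hx⟩, ⟨y, hy⟩, hz⟩ := hP a
  refine ⟨⟨x, tendsto_map'_iff.1 hx⟩, ⟨y, tendsto_map'_iff.1 hy⟩,
    hz.imp (fun h c => eventually_map.1 (h c)) ?_⟩
  rintro ⟨c, g, ξ, η, h1, h2⟩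
  refine ⟨c, g ∘ φ, ξ, η, eventually_map.1 h1, fun x hx => ?_⟩
  have := h2 x hx
  rw [Filter.prod_map_left, tendsto_map'_iff] at this
  exact this

/-- Provides the coordinate at `a` of the exceptional point. If `γ n` moves the vertex `a` off to
infinity, it is the limit direction from `a` to `(γ n)⁻¹ * δ`, independent of `δ`. Otherwise `γ n`
acts near `a` through a collapsing sequence of `G`; directions are moved by its inverse and tend to
η because they are nonconical. -/
theorem IsDirectionSystem.exists_repelling [CompactSpace M] [ContinuousConstSMul G M] [Infinite M]
    (h : IsDirectionSystem i d short) (hd : ∀ γ, γ ∉ i.range → IsNonconical G (d γ))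
    {γ : ℕ → Λ} (hγ : Function.Injective γ) (a : Λ)
    (hx : ∃ x, Tendsto (fun n => d (a⁻¹ * (γ n)⁻¹)) atTop (𝓝 x))
    (hS : (∀ c, ∀ᶠ n in atTop, c⁻¹ * (γ n * a) ∉ i.range) ∨
      ∃ (c : Λ) (g : ℕ → G) (ξ η : M), (∀ᶠ n in atTop, γ n * a = c * i (g n)) ∧
        Collapses g ξ η) :
    ∃ η : M, (∀ δ, (∀ᶠ n in atTop, δ⁻¹ * (γ n * a) ∉ i.range) →
        Tendsto (fun n => d (a⁻¹ * (γ n)⁻¹ * δ)) atTop (𝓝 η)) ∧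
      ∀ c, (∃ᶠ n in atTop, c⁻¹ * (γ n * a) ∈ i.range) →
        ∃ (g : ℕ → G) (ξ : M), (∀ᶠ n in atTop, γ n * a = c * i (g n)) ∧ Collapses g ξ η := by
  rcases hS with hS | ⟨c₀, g, ξ, η, hg, hcol⟩
  · obtain ⟨x, hx⟩ := hx
    refine ⟨x, fun δ _ => ?_, fun c hc => (hc (hS c)).elim⟩
    refine hx.congr' ?_
    filter_upwards [h.eventually_direction_eq hS δ 1] with n hn
    rw [hn, mul_one]
  · refine ⟨η, fun δ hδ => ?_, fun c hc => ?_⟩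
    · obtain ⟨N, hN⟩ := eventually_atTop.1 hg
      have hinj : Set.InjOn (fun n => (g n)⁻¹) (Set.Ici N) := by
        intro m hm n hn hmn
        have h1 := (hN m hm).trans ((congrArg (fun x => c₀ * i x) (inv_injective hmn)).trans
          (hN n hn).symm)
        exact hγ (mul_right_cancel h1)
      obtain ⟨n, h1, h2⟩ := (hδ.and hg).exists
      have hδ' : c₀⁻¹ * δ ∉ i.range := by
        rintro ⟨k, hk⟩
        refine h1 ⟨k⁻¹ * g n, ?_⟩
        rw [h2, _root_.map_mul, map_inv, hk]
        group
      refine ((hd _ hδ').tendsto hinj hcol.inv).congr' ?_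
      filter_upwards [hg] with n hn
      rw [← h.map_mul _ _ hδ', map_inv, show i (g n) = c₀⁻¹ * (γ n * a) by rw [hn]; group]
      congr 1
      group
    · obtain ⟨n, ⟨k, hk⟩, h2⟩ := (hc.and_eventually hg).exists
      refine ⟨fun m => k * (g n)⁻¹ * g m, _, ?_, hcol.mul_left _⟩
      filter_upwards [hg] with m hm
      rw [hm, _root_.map_mul, _root_.map_mul, hk, h2, map_inv]
      group

/-- Dual to the previous lemma: the coordinate at `δ` of the attracting point. One point serves for
all `a`, because two sequences of `G` bringing vertices to `δ` differ eventually by a fixed right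
factor, and because nonconical directions follow the collapse. -/
theorem IsDirectionSystem.exists_attracting [ContinuousConstSMul G M] [Infinite M]
    (h : IsDirectionSystem i d short) (hd : ∀ γ, γ ∉ i.range → IsNonconical G (d γ))
    {γ : ℕ → Λ} (hγ : Function.Injective γ) (δ : Λ)
    (hy : ∃ x, Tendsto (fun n => d (δ⁻¹ * γ n)) atTop (𝓝 x)) {η : Λ → M}
    (hη : ∀ a, (∃ᶠ n in atTop, δ⁻¹ * (γ n * a) ∈ i.range) →
        ∃ (g : ℕ → G) (ξ : M), (∀ᶠ n in atTop, γ n * a = δ * i (g n)) ∧ Collapses g ξ (η a)) :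
    ∃ ξ : M, (∀ a, (∀ᶠ n in atTop, δ⁻¹ * (γ n * a) ∉ i.range) →
        Tendsto (fun n => d (δ⁻¹ * γ n * a)) atTop (𝓝 ξ)) ∧
      ∀ a, (∃ᶠ n in atTop, δ⁻¹ * (γ n * a) ∈ i.range) →
        ∃ g : ℕ → G, (∀ᶠ n in atTop, γ n * a = δ * i (g n)) ∧ Collapses g ξ (η a) := by
  by_cases hex : ∃ a, ∃ᶠ n in atTop, δ⁻¹ * (γ n * a) ∈ i.range
  · obtain ⟨a, ha⟩ := hex
    obtain ⟨g, ξ, hg, hcol⟩ := hη a ha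
    refine ⟨ξ, fun b hb => ?_, fun b hb => ?_⟩
    · obtain ⟨N, hN⟩ := eventually_atTop.1 hg
      have hinj : Set.InjOn g (Set.Ici N) := by
        intro m hm n hn hmn
        have h1 := (hN m hm).trans ((congrArg (fun x => δ * i x) hmn).trans (hN n hn).symm)
        exact hγ (mul_right_cancel h1)
      obtain ⟨n, h1, h2⟩ := (hb.and hg).exists
      have hab : a⁻¹ * b ∉ i.range := by
        rintro ⟨k, hk⟩
        refine h1 ⟨g n * k, ?_⟩
        rw [_root_.map_mul, hk, show i (g n) = δ⁻¹ * (γ n * a) by rw [h2]; group]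
        group
      refine ((hd _ hab).tendsto hinj hcol).congr' ?_
      filter_upwards [hg] with n hn
      rw [← h.map_mul _ _ hab, show i (g n) = δ⁻¹ * (γ n * a) by rw [hn]; group]
      congr 1
      group
    · obtain ⟨g', ξ', hg', hcol'⟩ := hη b hb
      obtain ⟨n, h1, h2⟩ := (hg.and hg').exists
      have hk : ∀ᶠ m in atTop, g m * ((g n)⁻¹ * g' n) = g' m := by
        filter_upwards [hg, hg'] with m h3 h4
        apply h.injective
        rw [_root_.map_mul, _root_.map_mul, map_inv, show i (g m) = δ⁻¹ * (γ m * a) by rw [h3]; group,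
          show i (g n) = δ⁻¹ * (γ n * a) by rw [h1]; group,
          show i (g' m) = δ⁻¹ * (γ m * b) by rw [h4]; group,
          show i (g' n) = δ⁻¹ * (γ n * b) by rw [h2]; group]
        group
      have := ((hcol.mul_right ((g n)⁻¹ * g' n)).congr' hk).eq_left hcol'
      subst this
      exact ⟨g', hg', hcol'⟩
  · push Not at hex
    obtain ⟨x, hx⟩ := hy
    refine ⟨x, fun a _ => ?_, fun a ha => (ha (hex a)).elim⟩
    have hex' : ∀ c, ∀ᶠ n in atTop, c⁻¹ * ((γ n)⁻¹ * δ) ∉ i.range := fun c => by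
      filter_upwards [hex c] with n hn
      rw [← inv_mem_iff]
      simpa [mul_assoc] using hn
    refine hx.congr' ?_
    filter_upwards [h.eventually_direction_eq hex' a 1] with n hn
    rw [inv_inv, mul_one] at hn
    exact hn.symm

/-- The combination theorem: the glued space carries a convergence action as soon as none of the
directions is conical. -/
theorem IsDirectionSystem.isConvergenceAction [CompactSpace M]
    [ContinuousConstSMul G M] [Infinite M] [FirstCountableTopology M] [Countable Λ]
    (h : IsDirectionSystem i d short) (hG : IsConvergenceAction G M)
    (hd : ∀ γ, γ ∉ i.range → IsNonconical G (d γ)) :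
    IsConvergenceAction Λ (directionSpace i d) := by
  have hcl : IsClosed (directionSpace i d) := isClosed_directionSpace
  have := isCompact_iff_compactSpace.1 hcl.isCompact
  refine isConvergenceAction_iff.2 fun γ₀ hγ₀ => ?_
  obtain ⟨φ, hφ, hsub⟩ := exists_subsequence_directions i d hG hγ₀
  refine ⟨φ, hφ, ?_⟩
  have hγ := hγ₀.comp hφ.injective
  change Function.Injective fun n => γ₀ (φ n) at hγ
  change ∃ ξ η, Collapses (fun n => γ₀ (φ n)) ξ η
  set γ := fun n => γ₀ (φ n)
  have hη := fun a => h.exists_repelling hd hγ a (hsub a).1 (hsub a).2.2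
  choose η hηA hηB using hη
  have hξ := fun δ => h.exists_attracting hd hγ δ (hsub δ).2.1 fun a ha => hηB a δ ha
  choose ξ hξC hξD using hξ
  -- Choose `a` with `f a ≠ η a`. If `γ n` brings `a` to `δ`, the coordinate at `δ` is the image of
  -- `f a` under a collapsing sequence. Otherwise the direction from `a` to `(γ n)⁻¹ * δ` tends to
  -- `η a`, so nearby points do not have it as coordinate; the compatibility condition then forces
  -- the coordinate at `(γ n)⁻¹ * δ` to be the direction of `a`, which tends to `ξ δ`.
  have key : ∀ f : directionSpace i d, f.1 ≠ η →
      Tendsto (fun q : ℕ × directionSpace i d => (γ q.1 • q.2).1) (atTop ×ˢ 𝓝 f) (𝓝 ξ) := by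
    intro f hf
    obtain ⟨a, ha⟩ := Function.ne_iff.1 hf
    have heval : Tendsto (fun q : ℕ × directionSpace i d => q.2.1 a) (atTop ×ˢ 𝓝 f) (𝓝 (f.1 a)) :=
      (((continuous_apply a).comp continuous_subtype_val).tendsto f).comp tendsto_snd
    refine tendsto_pi_nhds.2 fun δ => ?_
    simp only [directionSpace.smul_apply]
    by_cases hδ : ∃ᶠ n in atTop, δ⁻¹ * (γ n * a) ∈ i.range
    · obtain ⟨g, hg, hcol⟩ := hξD δ a hδ
      refine ((hcol _ ha).comp (tendsto_fst.prodMk heval)).congr' ?_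
      filter_upwards [hg.prod_inl (𝓝 f)] with q hq
      change g q.1 • q.2.1 a = _
      rw [show (γ q.1)⁻¹ * δ = a * i (g q.1)⁻¹ by
        rw [map_inv, show i (g q.1) = δ⁻¹ * (γ q.1 * a) by rw [hq]; group]; group, q.2.2.1, inv_inv]
    · rw [not_frequently] at hδ
      have h1 := (hηA a δ hδ).comp (tendsto_fst (f := atTop) (g := 𝓝 f))
      have h2 := (heval.prodMk_nhds h1).eventually (isClosed_diagonal.isOpen_compl.mem_nhds ha)
      refine ((hξC δ a hδ).comp (tendsto_fst (f := atTop) (g := 𝓝 f))).congr' ?_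
      filter_upwards [h2, hδ.prod_inl (𝓝 f)] with q hq hq'
      have := (q.2.2.2 ((γ q.1)⁻¹ * δ) a (by simpa [mul_assoc] using hq')).resolve_right
        (fun e => hq (e.trans (by simp [mul_assoc])))
      rw [this]
      simp [mul_assoc]
  obtain ⟨f, hf⟩ : ∃ f : directionSpace i d, f.1 ≠ η := by
    obtain ⟨m, hm⟩ := exists_ne (η 1)
    obtain ⟨f, hf⟩ := h.exists_mem_directionSpace m
    exact ⟨f, fun e => hm (by rw [← hf, e])⟩
  have hξmem : ξ ∈ directionSpace i d := by
    refine hcl.mem_of_tendsto ((key f hf).comp (tendsto_id.prodMk tendsto_const_nhds))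
      (Eventually.of_forall fun n => ?_)
    exact (γ n • f).2
  -- The family η need not be shown compatible: if it is not a point of the space, nothing is
  -- exceptional and any point will do.
  obtain ⟨η', hη'⟩ : ∃ η' : directionSpace i d, ∀ f, f ≠ η' → f.1 ≠ η := by
    by_cases hη : η ∈ directionSpace i d
    · exact ⟨⟨η, hη⟩, fun f hf e => hf (Subtype.ext e)⟩
    · exact ⟨f, fun f' _ e => hη (e ▸ f'.2)⟩
  refine ⟨⟨ξ, hξmem⟩, η', fun f' hf' => ?_⟩
  rw [tendsto_subtype_rng]
  exact key f' (hη' f' hf')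

end Convergence

/-- The coordinate at the identity is a `G`-equivariant map to `M`, so a finite invariant set would
project to a finite invariant set in `M`. -/
theorem IsWildAction.directionSpace {G₀ G Λ M : Type*} [Group G₀] [Group G] [Group Λ] [Countable Λ]
    [TopologicalSpace M] [MulAction G M] {j : G₀ →* G} (hM : IsWildAction j M) {i : G →* Λ}
    {d : Λ → M} {short : Set Λ} (h : IsDirectionSystem i d short)
    (hd : ∀ γ, γ ∉ i.range → IsNonconical G (d γ)) :
    IsWildAction (i.comp j) (directionSpace i d) := by
  obtain ⟨h1, h2, h3, h4, h5, h6⟩ := id hM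
  have hinf := hM.infinite
  have hcl : IsClosed (_root_.directionSpace i d) := isClosed_directionSpace
  refine ⟨isCompact_iff_compactSpace.1 hcl.isCompact, inferInstance, ⟨fun γ => ?_⟩,
    h.isConvergenceAction h4 hd, ?_, fun F hF hF' => ?_⟩
  · refine Continuous.subtype_mk ?_ _
    exact continuous_pi fun x => (continuous_apply (γ⁻¹ * x)).comp continuous_subtype_val
  · obtain ⟨m⟩ := h5
    exact ⟨(h.exists_mem_directionSpace m).choose⟩
  · obtain ⟨g, _, ⟨f, hf, rfl⟩, hg⟩ := h6 _ (hF.image fun f => f.1 1) (hF'.image _)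
    refine ⟨g, f, hf, fun hc => hg ⟨_, hc, ?_⟩⟩
    change f.1 ((i (j g))⁻¹ * 1) = j g • f.1 1
    have := f.2.1 1 (j g)⁻¹
    rw [inv_inv, map_inv, one_mul] at this
    rw [mul_one, this]

/-- The property of being wild passes to subgroups containing the image of `G`. -/
theorem IsWildAction.compHom {G Λ Λ' M : Type*} [Group G] [Group Λ] [Group Λ']
    [TopologicalSpace M] [MulAction Λ M] {j : G →* Λ} (h : IsWildAction j M) (e : Λ' →* Λ)
    (he : Function.Injective e) {j' : G →* Λ'} (hj : e.comp j' = j) :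
    let _ := MulAction.compHom M e
    IsWildAction j' M := by
  let _ := MulAction.compHom M e
  obtain ⟨h1, h2, h3, h4, h5, h6⟩ := id h
  refine ⟨h1, h2, ⟨fun g => continuous_const_smul (e g)⟩, fun γ hγ => h4 (e ∘ γ) (he.comp hγ), h5,
    fun F hF hF' => ?_⟩
  obtain ⟨g, x, hx, hg⟩ := h6 F hF hF'
  refine ⟨g, x, hx, ?_⟩
  rw [← hj] at hg
  exact hg

theorem IsWildAction.exists_of_isDirectionSystem {G₀ G Λ : Type*} {M : Type} [Group G₀] [Group G]
    [Group Λ] [Countable Λ] [TopologicalSpace M] [MulAction G M] {j : G₀ →* G}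
    (hM : IsWildAction j M) {i : G →* Λ} {d : Λ → M} {short : Set Λ}
    (h : IsDirectionSystem i d short) (hd : ∀ γ, γ ∉ i.range → IsNonconical G (d γ)) :
    ∃ (N : Type) (_ : TopologicalSpace N) (_ : MulAction Λ N), IsWildAction (i.comp j) N := by
  -- The glued space consists of functions on the group; replacing the countable group by a small
  -- copy keeps it in `Type`.
  let e : Shrink.{0} Λ ≃* Λ := Shrink.mulEquiv
  have h' := h.congr e
  have : Countable (Shrink.{0} Λ) := e.toEquiv.countable_iff.2 inferInstance
  have hw := hM.directionSpace h' fun γ hγ => hd (e γ) fun ⟨g, hg⟩ => hγ ⟨g, by simp [hg]⟩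
  refine ⟨_, _, _, hw.compHom (e.symm : Λ →* Shrink.{0} Λ) e.symm.injective ?_⟩
  rfl

/-! ### Directions in HNN extensions -/

namespace HNNExtension

variable {G : Type*} [Group G] {A B : Subgroup G} (φ : A ≃* B)

/-- `IsReduced φ n u v x` says that `x` has a reduced expression with `n` stable letters, which starts
with `t ^ u` and ends with `t ^ v`. -/
inductive IsReduced : ℕ → ℤˣ → ℤˣ → HNNExtension G A B φ → Prop
  | single (u : ℤˣ) : IsReduced 1 u u (t ^ (u : ℤ))
  | cons (u : ℤˣ) (g : G) {n : ℕ} {u' v : ℤˣ} {x : HNNExtension G A B φ} (hx : IsReduced n u' v x)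
      (h : g ∈ toSubgroup A B u → u = u') : IsReduced (n + 1) u v (t ^ (u : ℤ) * of g * x)

variable {φ}

theorem IsReduced.pos {n : ℕ} {u v : ℤˣ} {x : HNNExtension G A B φ} (h : IsReduced φ n u v x) :
    1 ≤ n := by
  cases h <;> omega

theorem IsReduced.append {n m : ℕ} {u v u' v' : ℤˣ} {x y : HNNExtension G A B φ} {g : G}
    (hx : IsReduced φ n u v x) (hy : IsReduced φ m u' v' y)
    (h : g ∈ toSubgroup A B v → v = u') : IsReduced φ (n + m) u v' (x * of g * y) := by
  induction hx with
  | single u => rw [add_comm]; exact .cons u g hy h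
  | cons u g' hx h' ih =>
    have := IsReduced.cons u g' (ih h) h'
    rw [add_right_comm]
    simpa only [mul_assoc] using this

theorem IsReduced.inv {n : ℕ} {u v : ℤˣ} {x : HNNExtension G A B φ} (h : IsReduced φ n u v x) :
    IsReduced φ n (-v) (-u) x⁻¹ := by
  induction h with
  | single u =>
    have := IsReduced.single (φ := φ) (-u)
    rwa [Units.val_neg, zpow_neg] at this
  | @cons u g n u' v x hx h ih =>
    have hc : g⁻¹ ∈ toSubgroup A B (-u') → -u' = -u := by
      intro hg
      by_contra hne
      have hu : u = -u' := by
        rcases Int.units_eq_one_or u with rfl | rfl <;>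
          rcases Int.units_eq_one_or u' with rfl | rfl <;> simp_all
      rw [← hu, inv_mem_iff] at hg
      exact hne (congrArg Neg.neg (h hg).symm)
    have := ih.append (IsReduced.single (-u)) hc
    rw [Units.val_neg, zpow_neg] at this
    rw [mul_inv_rev, mul_inv_rev, ← map_inv, ← mul_assoc]
    exact this

/-- The element of an HNN extension spelled by a list of syllables. -/
abbrev listProd (φ : A ≃* B) (l : List (ℤˣ × G)) : HNNExtension G A B φ :=
  (l.map fun x => t ^ (x.1 : ℤ) * of x.2).prod

theorem IsReduced.exists_list {n : ℕ} {u v : ℤˣ} {x : HNNExtension G A B φ}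
    (h : IsReduced φ n u v x) (g₁ : G) : ∃ (g : G) (l : List (ℤˣ × G)),
      ((u, g) :: l).IsChain (fun a b => a.2 ∈ toSubgroup A B a.1 → a.1 = b.1) ∧
      listProd φ ((u, g) :: l) = x * of g₁ ∧ l.length + 1 = n := by
  induction h with
  | single u => exact ⟨g₁, [], List.isChain_singleton _, by simp [listProd], rfl⟩
  | cons u g hx h ih =>
    obtain ⟨g', l, h1, h2, h3⟩ := ih
    refine ⟨g, _ :: l, List.isChain_cons_cons.2 ⟨h, h1⟩, ?_, by simp [h3]⟩
    rw [listProd, List.map_cons, List.prod_cons]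
    change _ * listProd φ _ = _
    rw [h2, ← mul_assoc]

theorem exists_isReduced_of_list (u : ℤˣ) (g : G) (l : List (ℤˣ × G))
    (h : ((u, g) :: l).IsChain (fun a b => a.2 ∈ toSubgroup A B a.1 → a.1 = b.1)) :
    ∃ (n : ℕ) (v : ℤˣ) (x : HNNExtension G A B φ) (g₁ : G), IsReduced φ n u v x ∧
      listProd φ ((u, g) :: l) = x * of g₁ := by
  induction l generalizing u g with
  | nil => exact ⟨1, u, _, g, .single u, by simp [listProd]⟩
  | cons a l ih =>
    obtain ⟨n, v, x, g₁, hx, h1⟩ := ih a.1 a.2 (List.isChain_cons_cons.1 h).2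
    refine ⟨n + 1, v, _, g₁, .cons u g hx (List.isChain_cons_cons.1 h).1, ?_⟩
    rw [listProd, List.map_cons, List.prod_cons]
    change _ * listProd φ ((a.1, a.2) :: l) = _
    rw [h1, ← mul_assoc]

theorem exists_isReduced (γ : HNNExtension G A B φ)
    (hγ : γ ∉ (of : G →* HNNExtension G A B φ).range) :
    ∃ (n : ℕ) (u v : ℤˣ) (x : HNNExtension G A B φ) (g₀ g₁ : G), IsReduced φ n u v x ∧
      γ = of g₀ * x * of g₁ := by
  obtain ⟨d⟩ := NormalWord.TransversalPair.nonempty G A B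
  have hw : (NormalWord.equiv φ d γ).prod φ = γ := (NormalWord.equiv φ d).symm_apply_apply γ
  set w := NormalWord.equiv φ d γ
  rcases hl : w.toList with _ | ⟨⟨u, g⟩, l⟩
  · refine (hγ ⟨w.head, ?_⟩).elim
    rw [← hw]
    simp [NormalWord.ReducedWord.prod, hl]
  · obtain ⟨n, v, x, g₁, hx, h1⟩ := exists_isReduced_of_list (φ := φ) u g l (hl ▸ w.chain)
    refine ⟨n, u, v, x, w.head, g₁, hx, ?_⟩
    rw [mul_assoc, ← h1, ← hw, NormalWord.ReducedWord.prod, hl]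

/-- Britton's lemma: reduced expressions differ only by moving subgroup elements across stable
letters. Hence the first stable letter and the coset of the element before it depend on the product
alone, which makes directions well defined. -/
theorem IsReduced.unique {n m : ℕ} {u v u' v' : ℤˣ} {x y : HNNExtension G A B φ}
    {g₀ g₁ h₀ h₁ : G} (hx : IsReduced φ n u v x) (hy : IsReduced φ m u' v' y)
    (h : of g₀ * x * of g₁ = of h₀ * y * of h₁) :
    n = m ∧ u = u' ∧ g₀⁻¹ * h₀ ∈ toSubgroup A B (-u) := by
  obtain ⟨g, l, h1, h2, h3⟩ := hx.exists_list g₁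
  obtain ⟨g', l', h1', h2', h3'⟩ := hy.exists_list h₁
  have := ReducedWord.map_fst_eq_and_of_prod_eq φ (w₁ := ⟨g₀, _, h1⟩)
    (w₂ := ⟨h₀, _, h1'⟩) (by
      change of g₀ * listProd φ _ = of h₀ * listProd φ _
      rw [h2, h2', ← mul_assoc, ← mul_assoc, h])
  obtain ⟨h4, h5⟩ := this
  simp only [List.map_cons, List.cons.injEq] at h4
  refine ⟨?_, h4.1, h5 u (by simp)⟩
  rw [← h3, ← h3']
  simpa using congrArg List.length h4.2

theorem IsReduced.notMem_range {n : ℕ} {u v : ℤˣ} {x : HNNExtension G A B φ}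
    (hx : IsReduced φ n u v x) (g₀ g₁ : G) :
    of g₀ * x * of g₁ ∉ (of : G →* HNNExtension G A B φ).range := by
  intro h
  obtain ⟨g, l, h1, h2, -⟩ := hx.exists_list g₁
  have := ReducedWord.toList_eq_nil_of_mem_of_range φ ⟨g₀, _, h1⟩ (by
    change of g₀ * listProd φ _ ∈ _
    rwa [h2, ← mul_assoc])
  simp at this

/-- The Bass-Serre tree of an HNN extension gives a system of directions, once the two associated
subgroups fix points. -/
theorem exists_isDirectionSystem {M : Type*} [MulAction G M] (p : ℤˣ → M)
    (hp : ∀ u, ∀ g ∈ toSubgroup A B (-u), g • p u = p u) :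
    ∃ (d : HNNExtension G A B φ → M) (short : Set (HNNExtension G A B φ)),
      IsDirectionSystem (of : G →* HNNExtension G A B φ) d short ∧
      ∀ γ, γ ∉ (of : G →* HNNExtension G A B φ).range → ∃ (g : G) (u : ℤˣ), d γ = g • p u := by
  have hex : ∀ γ : HNNExtension G A B φ, ∃ m : M,
      γ ∉ (of : G →* HNNExtension G A B φ).range → ∃ (n : ℕ) (u v : ℤˣ)
        (x : HNNExtension G A B φ) (g₀ g₁ : G), IsReduced φ n u v x ∧ γ = of g₀ * x * of g₁ ∧
          m = g₀ • p u := by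
    intro γ
    by_cases hγ : γ ∈ (of : G →* HNNExtension G A B φ).range
    · exact ⟨p 1, fun h => (h hγ).elim⟩
    · obtain ⟨n, u, v, x, g₀, g₁, hx, h⟩ := exists_isReduced γ hγ
      exact ⟨g₀ • p u, fun _ => ⟨n, u, v, x, g₀, g₁, hx, h, rfl⟩⟩
  choose d hd using hex
  have hcoset : ∀ {u : ℤˣ} {g h : G}, g⁻¹ * h ∈ toSubgroup A B (-u) → h • p u = g • p u := by
    intro u g h hgh
    have := congrArg (g • ·) (hp u _ hgh)
    simpa only [smul_smul, mul_inv_cancel_left] using this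
  have hd' : ∀ {n u v x} (_ : IsReduced φ n u v x) (g₀ g₁ : G),
      d (of g₀ * x * of g₁) = g₀ • p u := by
    intro n u v x hx g₀ g₁
    obtain ⟨m, u', v', y, h₀, h₁, hy, h1, h2⟩ := hd _ (hx.notMem_range g₀ g₁)
    obtain ⟨-, rfl, h3⟩ := hx.unique hy h1
    rw [h2, hcoset h3]
  refine ⟨d, (of : G →* HNNExtension G A B φ).range ∪ {t}, ⟨of_injective φ, ?_, ?_, ?_,
    Set.subset_union_left, ?_⟩, ?_⟩
  · intro g γ hγ
    obtain ⟨n, u, v, x, g₀, g₁, hx, rfl⟩ := exists_isReduced γ hγ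
    rw [hd' hx, ← mul_assoc, ← mul_assoc, ← map_mul, hd' hx, mul_smul]
  · intro g γ hγ
    obtain ⟨n, u, v, x, g₀, g₁, hx, rfl⟩ := exists_isReduced γ hγ
    rw [hd' hx, mul_assoc, ← map_mul, hd' hx]
  · intro γ γ' hγ hγ' hne
    obtain ⟨n, u, v, x, g₀, g₁, hx, rfl⟩ := exists_isReduced γ hγ
    obtain ⟨m, u', v', y, h₀, h₁, hy, rfl⟩ := exists_isReduced γ' hγ'
    rw [hd' hx, hd' hy] at hne
    -- A cancellation between `x⁻¹` and `y` would need `u' = u` and `g₀⁻¹ * h₀` in the stabilizer of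
    -- `p u`; the two directions would then agree.
    have hc : g₀⁻¹ * h₀ ∈ toSubgroup A B (-u) → -u = u' := by
      intro hg
      by_contra hu
      have huu : u' = u := by
        rcases Int.units_eq_one_or u with rfl | rfl <;>
          rcases Int.units_eq_one_or u' with rfl | rfl <;> simp_all
      rw [huu] at hne
      exact hne (hcoset hg).symm
    have hxy := hx.inv.append hy hc
    have e1 : (of g₀ * x * of g₁)⁻¹ * (of h₀ * y * of h₁) =
        of g₁⁻¹ * (x⁻¹ * of (g₀⁻¹ * h₀) * y) * of h₁ := by
      simp only [map_mul, map_inv, mul_inv_rev, mul_assoc]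
    have e2 : (of g₀ * x * of g₁)⁻¹ = of g₁⁻¹ * x⁻¹ * of g₀⁻¹ := by
      simp only [map_inv, mul_inv_rev, mul_assoc]
    rw [e1, e2, hd' hxy, hd' hx.inv]
    refine ⟨?_, rfl⟩
    rintro (h | h)
    · exact hxy.notMem_range _ _ h
    · have h1 : IsReduced φ 1 1 1 (t : HNNExtension G A B φ) := by
        simpa using IsReduced.single (φ := φ) 1
      have := (hxy.unique h1 (g₀ := g₁⁻¹) (g₁ := h₁) (h₀ := 1) (h₁ := 1)
        (by simpa using h)).1
      have := hx.pos
      have := hy.pos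
      omega
  · refine eq_top_iff.2 fun γ _ => ?_
    induction γ using HNNExtension.induction_on with
    | of g => exact Subgroup.subset_closure (Or.inl ⟨g, rfl⟩)
    | t => exact Subgroup.subset_closure (Or.inr rfl)
    | mul a b ha hb => exact mul_mem (ha trivial) (hb trivial)
    | inv a ha => exact inv_mem (ha trivial)
  · intro γ hγ
    obtain ⟨n, u, v, x, g₀, g₁, hx, h, h1⟩ := hd γ hγ
    exact ⟨g₀, u, h1⟩

end HNNExtension

/-! ### Directions in free products -/

namespace Monoid.CoprodI

variable {ι : Type*} {H : ι → Type*} [∀ i, Group (H i)]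

theorem eq_and_eq_of_mul_prod_eq {v : ι} {g h : H v} {w w' : Word H} (hw : w.fstIdx ≠ some v)
    (hw' : w'.fstIdx ≠ some v) (e : of g * w.prod = of h * w'.prod) : g = h ∧ w = w' := by
  classical
  have h1 : Word.rcons ⟨g, w, hw⟩ = Word.rcons ⟨h, w', hw'⟩ := by
    apply Word.equiv.symm.injective
    change (Word.rcons _).prod = (Word.rcons _).prod
    rw [Word.prod_rcons, Word.prod_rcons]
    exact e
  have h2 := Word.rcons_inj h1
  simp only [Word.Pair.mk.injEq] at h2
  exact h2

/-- The letter `g` is appended only if it is nontrivial; the first letter, on which the comparison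
of normal forms rests, is unaffected. -/
theorem NeWord.exists_word_mul_of {v i j : ι} (w : NeWord H i j) (hj : j ≠ v) (g : H v) :
    ∃ W : Word H, W.fstIdx = some i ∧ W.prod = w.prod * of g ∧
      w.toList.length ≤ W.toList.length := by
  by_cases hg : g = 1
  · refine ⟨w.toWord, ?_, ?_, le_rfl⟩
    · change w.toList.head?.map _ = _
      simp
    · rw [hg, map_one, mul_one]
      rfl
  · refine ⟨(w.append hj (.singleton g hg)).toWord, ?_, ?_, ?_⟩
    · change (w.append hj (.singleton g hg)).toList.head?.map _ = _
      rw [NeWord.toList_head?]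
      rfl
    · change (w.append hj (.singleton g hg)).prod = _
      simp
    · simp [NeWord.toWord]

theorem NeWord.notMem_range {v i j : ι} (w : NeWord H i j) (hi : i ≠ v) (hj : j ≠ v)
    (g₀ g₁ : H v) : of g₀ * w.prod * of g₁ ∉ (of : H v →* CoprodI H).range := by
  rintro ⟨h, hh⟩
  obtain ⟨W, h1, h2, h3⟩ := w.exists_word_mul_of hj g₁
  have := (eq_and_eq_of_mul_prod_eq (v := v) (g := g₀) (h := h) (w := W) (w' := Word.empty)
    (by simpa [h1] using hi) (by simp [Word.fstIdx]) (by
      rw [h2, ← mul_assoc, ← hh, Word.prod_empty, mul_one])).2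
  rw [this] at h1
  simp [Word.fstIdx] at h1

theorem NeWord.unique {v i j i' j' : ι} (w : NeWord H i j) (w' : NeWord H i' j') (hi : i ≠ v)
    (hj : j ≠ v) (hi' : i' ≠ v) (hj' : j' ≠ v) {g₀ g₁ h₀ h₁ : H v}
    (e : of g₀ * w.prod * of g₁ = of h₀ * w'.prod * of h₁) : g₀ = h₀ := by
  obtain ⟨W, h1, h2, -⟩ := w.exists_word_mul_of hj g₁
  obtain ⟨W', h1', h2', -⟩ := w'.exists_word_mul_of hj' h₁
  refine (eq_and_eq_of_mul_prod_eq (w := W) (w' := W') (by simpa [h1] using hi)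
    (by simpa [h1'] using hi') ?_).1
  rw [h2, h2', ← mul_assoc, e, mul_assoc]

theorem NeWord.length_pos {i j : ι} (w : NeWord H i j) : 0 < w.toList.length :=
  List.length_pos_iff.2 w.toList_ne_nil

/-- A reduced word with at least two letters does not lie in a factor. -/
theorem NeWord.ne_of {v i j k : ι} (w : NeWord H i j) (hi : i ≠ v) (hj : j ≠ v)
    (g₀ g₁ : H v) (hlen : 2 ≤ w.toList.length) (m : H k) : of g₀ * w.prod * of g₁ ≠ of m := by
  intro e
  by_cases hk : k = v
  · subst hk
    exact w.notMem_range hi hj g₀ g₁ ⟨m, e.symm⟩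
  by_cases hm : m = 1
  · subst hm
    exact w.notMem_range hi hj g₀ g₁ (by rw [e, map_one]; exact one_mem _)
  obtain ⟨W, h1, h2, h3⟩ := w.exists_word_mul_of hj g₁
  have := (eq_and_eq_of_mul_prod_eq (v := v) (g := g₀) (h := 1) (w := W)
    (w' := (NeWord.singleton m hm).toWord)
    (by simpa [h1] using hi) (by simpa [Word.fstIdx, NeWord.toWord] using hk) (by
      change _ = _ * (NeWord.singleton m hm).prod
      rw [h2, ← mul_assoc, e, map_one, one_mul, NeWord.prod_singleton])).2
  rw [this] at h3
  simp only [NeWord.toWord, NeWord.toList, List.length_singleton] at h3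
  omega

theorem exists_neWord (v : ι) (γ : CoprodI H) (hγ : γ ∉ (of : H v →* CoprodI H).range) :
    ∃ (i j : ι) (w : NeWord H i j) (g₀ g₁ : H v), i ≠ v ∧ j ≠ v ∧
      γ = of g₀ * w.prod * of g₁ := by
  classical
  -- The induction must remember whether the word begins in the factor `v`, since this decides how a
  -- further letter is absorbed.
  suffices key : ∀ w : Word H, w.prod ∈ (of : H v →* CoprodI H).range ∨
      ∃ (i j : ι) (w' : NeWord H i j) (g₀ g₁ : H v), i ≠ v ∧ j ≠ v ∧
        w.prod = of g₀ * w'.prod * of g₁ ∧ (w.fstIdx = some v → g₀ ≠ 1) ∧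
        (w.fstIdx ≠ some v → g₀ = 1 ∧ w.fstIdx = some i) by
    have h1 : (Word.equiv γ).prod = γ := Word.equiv.symm_apply_apply γ
    rcases key (Word.equiv γ) with h | ⟨i, j, w', g₀, g₁, hi, hj, h, -⟩
    · exact (hγ (h1 ▸ h)).elim
    · exact ⟨i, j, w', g₀, g₁, hi, hj, h1 ▸ h⟩
  intro w
  induction w using Word.consRecOn with
  | empty => exact Or.inl (by rw [Word.prod_empty]; exact one_mem _)
  | cons k m w h1 h2 ih =>
    rw [Word.prod_cons, Word.fstIdx_cons]
    by_cases hk : k = v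
    · subst hk
      rcases ih with h | ⟨i, j, w', g₀, g₁, hi, hj, h, -, h4⟩
      · exact Or.inl (mul_mem ⟨m, rfl⟩ h)
      · obtain ⟨rfl, -⟩ := h4 h1
        exact Or.inr ⟨i, j, w', m, g₁, hi, hj, by simp [h, mul_assoc], fun _ => h2, by simp⟩
    · right
      have hk' : some k ≠ some v := by simpa using hk
      rcases ih with ⟨g, h⟩ | ⟨i, j, w', g₀, g₁, hi, hj, h, h3, h4⟩
      · exact ⟨k, k, .singleton m h2, 1, g, hk, hk, by simp [h], fun e => (hk' e).elim,
          fun _ => ⟨rfl, rfl⟩⟩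
      · by_cases hv : w.fstIdx = some v
        · refine ⟨k, j, ((NeWord.singleton m h2).append hk (.singleton g₀ (h3 hv))).append hi.symm w',
            1, g₁, hk, hj, ?_, fun e => (hk' e).elim, fun _ => ⟨rfl, rfl⟩⟩
          simp [h, mul_assoc]
        · obtain ⟨rfl, h5⟩ := h4 hv
          have hki : k ≠ i := fun e => h1 (by rw [h5, e])
          refine ⟨k, j, (NeWord.singleton m h2).append hki w', 1, g₁, hk, hj, ?_,
            fun e => (hk' e).elim, fun _ => ⟨rfl, rfl⟩⟩
          simp [h, mul_assoc]

/-- The Bass-Serre tree of a free product gives a system of directions, for any choice of a base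
point. -/
theorem exists_isDirectionSystem {M : Type*} (v : ι) [MulAction (H v) M] (p : M) :
    ∃ (d : CoprodI H → M) (short : Set (CoprodI H)),
      IsDirectionSystem (of : H v →* CoprodI H) d short ∧
      ∀ γ, γ ∉ (of : H v →* CoprodI H).range → ∃ g : H v, d γ = g • p := by
  have hex : ∀ γ : CoprodI H, ∃ g : H v, γ ∉ (of : H v →* CoprodI H).range →
      ∃ (i j : ι) (w : NeWord H i j) (g₁ : H v), i ≠ v ∧ j ≠ v ∧ γ = of g * w.prod * of g₁ := by
    intro γ
    by_cases hγ : γ ∈ (of : H v →* CoprodI H).range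
    · exact ⟨1, fun h => (h hγ).elim⟩
    · obtain ⟨i, j, w, g₀, g₁, h⟩ := exists_neWord v γ hγ
      exact ⟨g₀, fun _ => ⟨i, j, w, g₁, h⟩⟩
  choose d hd using hex
  have hd' : ∀ {i j} (w : NeWord H i j) (_ : i ≠ v) (_ : j ≠ v) (g₀ g₁ : H v),
      d (of g₀ * w.prod * of g₁) = g₀ := by
    intro i j w hi hj g₀ g₁
    obtain ⟨i', j', w', g₁', hi', hj', h⟩ := hd _ (w.notMem_range hi hj g₀ g₁)
    exact (w.unique w' hi hj hi' hj' h).symm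
  refine ⟨fun γ => d γ • p, {γ | ∃ (i : ι) (m : H i), γ = of m},
    ⟨of_injective v, ?_, ?_, ?_, ?_, ?_⟩, fun γ _ => ⟨_, rfl⟩⟩
  · intro g γ hγ
    obtain ⟨i, j, w, g₀, g₁, hi, hj, rfl⟩ := exists_neWord v γ hγ
    rw [hd' w hi hj, ← mul_assoc, ← mul_assoc, ← map_mul, hd' w hi hj, mul_smul]
  · intro g γ hγ
    obtain ⟨i, j, w, g₀, g₁, hi, hj, rfl⟩ := exists_neWord v γ hγ
    rw [hd' w hi hj, mul_assoc, ← map_mul, hd' w hi hj]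
  · intro γ γ' hγ hγ' hne
    obtain ⟨i, j, w, g₀, g₁, hi, hj, rfl⟩ := exists_neWord v γ hγ
    obtain ⟨i', j', w', h₀, h₁, hi', hj', rfl⟩ := exists_neWord v γ' hγ'
    rw [hd' w hi hj, hd' w' hi' hj'] at hne
    have hg : g₀⁻¹ * h₀ ≠ 1 := fun e => hne (by rw [inv_mul_eq_one.1 e])
    -- The nontrivial element `g₀⁻¹ * h₀` of `H v` sits between letters of other factors, so nothing
    -- cancels and `W` has at least three letters.
    let W := (w.inv.append hi (.singleton _ hg)).append hi'.symm w'
    have e1 : (of g₀ * w.prod * of g₁)⁻¹ * (of h₀ * w'.prod * of h₁) =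
        of g₁⁻¹ * W.prod * of h₁ := by
      simp only [W, NeWord.append_prod, NeWord.inv_prod, NeWord.prod_singleton, map_mul, map_inv,
        mul_inv_rev, mul_assoc]
    have e2 : (of g₀ * w.prod * of g₁)⁻¹ = of g₁⁻¹ * w.inv.prod * of g₀⁻¹ := by
      simp only [NeWord.inv_prod, map_inv, mul_inv_rev, mul_assoc]
    rw [e1, e2, hd' W hj hj', hd' w.inv hj hi]
    refine ⟨?_, rfl⟩
    rintro ⟨k, m, h⟩
    refine W.ne_of hj hj' _ _ ?_ m h
    have := w'.length_pos
    simp only [W, NeWord.toList, List.length_append, List.length_singleton]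
    omega
  · rintro _ ⟨g, rfl⟩
    exact ⟨v, g, rfl⟩
  · refine eq_top_iff.2 fun γ _ => ?_
    induction γ using induction_on with
    | one => exact one_mem _
    | of i m => exact Subgroup.subset_closure ⟨i, m, rfl⟩
    | mul a b ha hb => exact mul_mem (ha trivial) (hb trivial)

end Monoid.CoprodI

/-! ### Countability of free products and HNN extensions -/

instance Monoid.Coprod.instCountable {M N : Type*} [Monoid M] [Monoid N] [Countable M]
    [Countable N] : Countable (Monoid.Coprod M N) :=
  have : Countable (FreeMonoid (M ⊕ N)) := inferInstanceAs (Countable (List (M ⊕ N)))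
  (Monoid.Coprod.mk_surjective (M := M) (N := N)).countable

instance Monoid.CoprodI.instCountable {ι : Type*} {M : ι → Type*} [∀ i, Monoid (M i)] [Countable ι]
    [∀ i, Countable (M i)] : Countable (Monoid.CoprodI M) :=
  have : Countable (FreeMonoid (Σ i, M i)) := inferInstanceAs (Countable (List (Σ i, M i)))
  (Con.mk'_surjective (c := conGen (Monoid.CoprodI.Rel M))).countable

instance HNNExtension.instCountable {G : Type*} [Group G] [Countable G] {A B : Subgroup G}
    (φ : A ≃* B) : Countable (HNNExtension G A B φ) :=
  have : Countable (Multiplicative ℤ) := inferInstanceAs (Countable ℤ)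
  (Con.mk'_surjective (c := HNNExtension.con G A B φ)).countable

/-! ### Countable groups -/

/-- Every countable group acts as a convergence group on its one-point compactification. -/
theorem isConvergenceGroup_of_countable (Γ : Type*) [Group Γ] [Countable Γ] :
    IsConvergenceGroup Γ := by
  classical
  rcases finite_or_infinite Γ with hfin | hinf
  · let act : MulAction Γ (Fin 3) :=
      { smul := fun _ x => x, one_smul := fun _ => rfl, mul_smul := fun _ _ _ => rfl }
    refine ⟨Fin 3, inferInstance, act, inferInstance, inferInstance,
      ⟨fun _ => continuous_id⟩, by simp, fun γ hγ => ?_⟩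
    exact (not_injective_infinite_finite γ hγ).elim
  · let S := Shrink.{0} Γ
    let e : Γ ≃* S := Shrink.mulEquiv.symm
    have hS : Countable S := e.symm.toEquiv.countable_iff.2 inferInstance
    have hSi : Infinite S := e.toEquiv.infinite_iff.1 hinf
    -- Indicator functions of sets with at most one element: the points of `S` together with the
    -- empty set as point at infinity.
    let X : Set (S → Bool) := {f | ∀ a b, f a = true → f b = true → a = b}
    have hX : IsClosed X := by
      simp only [X, Set.ofPred_forall]
      refine isClosed_iInter fun a => isClosed_iInter fun b => ?_
      by_cases hab : a = b
      · simp [hab]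
      · have : {f : S → Bool | f a = true → f b = true → a = b} =
            {f | f a = false} ∪ {f | f b = false} := by
          ext f
          simp only [hab, Set.mem_union, Set.mem_ofPred_eq]
          cases f a <;> cases f b <;> simp
        rw [this]
        exact (isClosed_eq (continuous_apply a) continuous_const).union
          (isClosed_eq (continuous_apply b) continuous_const)
    let act : MulAction Γ X :=
      { smul := fun γ f => ⟨fun x => f.1 ((e γ)⁻¹ * x), fun a b ha hb =>
          mul_left_cancel (f.2 _ _ ha hb)⟩
        one_smul := fun f => Subtype.ext <| funext fun x => by
          change f.1 ((e 1)⁻¹ * x) = f.1 x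
          simp
        mul_smul := fun γ γ' f => Subtype.ext <| funext fun x => by
          change f.1 ((e (γ * γ'))⁻¹ * x) = f.1 ((e γ')⁻¹ * ((e γ)⁻¹ * x))
          simp [mul_assoc] }
    have hc : CompactSpace X := isCompact_iff_compactSpace.1 hX.isCompact
    let o : X := ⟨fun _ => false, fun a b h => by simp at h⟩
    let pt : S → X := fun s => ⟨fun x => decide (x = s), fun a b ha hb => by simp_all⟩
    have hpt : Function.Injective pt := fun s s' h => by
      have := congrFun (congrArg Subtype.val h) s
      simpa [pt] using this
    have hXi : Infinite X := Infinite.of_injective pt hpt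
    refine ⟨X, inferInstance, act, hc, inferInstance, ⟨fun γ => ?_⟩, by simp, ?_⟩
    · refine Continuous.subtype_mk ?_ _
      exact continuous_pi fun x => (continuous_apply ((e γ)⁻¹ * x)).comp continuous_subtype_val
    · refine isConvergenceAction_iff.2 fun γ hγ => ⟨id, strictMono_id, o, o, fun f hf => ?_⟩
      rw [tendsto_subtype_rng]
      refine tendsto_pi_nhds.2 fun x => ?_
      obtain ⟨s, hs⟩ : ∃ s, f.1 s = true := by
        by_contra! h
        exact hf (Subtype.ext (funext fun s => by simpa using h s))
      have h1 : ∀ᶠ q : X in 𝓝 f, q.1 s = true := by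
        have : Continuous fun q : X => q.1 s := (continuous_apply s).comp continuous_subtype_val
        exact this.continuousAt.eventually_mem ((isOpen_discrete {true}).mem_nhds hs)
      have h2 : ∀ᶠ n in atTop, (e (γ n))⁻¹ * x ≠ s := by
        have hinj : Function.Injective fun n => (e (γ n))⁻¹ * x := fun m n h =>
          hγ (e.injective (inv_injective (mul_right_cancel h)))
        have := hinj.tendsto_cofinite.eventually (Set.finite_singleton s).compl_mem_cofinite
        rwa [Nat.cofinite_eq_atTop] at this
      refine tendsto_const_nhds.congr' ?_
      filter_upwards [h2.prod_mk h1] with q hq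
      change false = q.2.1 ((e (γ q.1))⁻¹ * x)
      by_contra h
      exact hq.1 (q.2.2 _ _ (by simpa using Ne.symm h) hq.2)

/-! ### Wild actions of free products and HNN extensions -/

theorem exists_isWildAction_of_isNonelementary {G : Type*} [Group G]
    (h : IsNonelementaryConvergenceGroup G) :
    Infinite G ∧ ∃ (M : Type) (_ : TopologicalSpace M) (_ : MulAction G M),
      IsWildAction (MonoidHom.id G) M := by
  obtain ⟨M, _, _, h1, h2, h3, h4, h5, h6, h7⟩ := h
  refine ⟨h6, M, _, _, h1, h2, h3, h5, ?_, fun F hF hF' => ?_⟩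
  · by_contra hM
    rw [not_nonempty_iff] at hM
    rw [ENat.card_eq_zero_iff_empty M |>.2 hM] at h4
    exact absurd h4 (by norm_num)
  · by_contra! hinv
    obtain ⟨g, x, hx, hg⟩ := h7 F hF' (h5.encard_le_two hF hinv)
    exact hg (hinv g x hx)

/-- A free product inherits a wild action from a factor containing an element of infinite order. -/
theorem IsWildAction.exists_coprodI {ι : Type*} {H : ι → Type*} [∀ i, Group (H i)] [Countable ι]
    [∀ i, Countable (H i)] {v : ι} {M : Type} [TopologicalSpace M] [MulAction (H v) M]
    (h : IsWildAction (MonoidHom.id (H v)) M) {c : H v} (hc : ¬ IsOfFinOrder c) :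
    ∃ (N : Type) (_ : TopologicalSpace N) (_ : MulAction (Monoid.CoprodI H) N),
      IsWildAction (Monoid.CoprodI.of : H v →* Monoid.CoprodI H) N := by
  obtain ⟨M', _, _, hM', ⟨p, -, hp⟩, -⟩ := h.exists_isNonconical hc
  have := hM'.continuous
  obtain ⟨d, short, hd, hd'⟩ := Monoid.CoprodI.exists_isDirectionSystem (H := H) v p
  refine hM'.exists_of_isDirectionSystem hd fun γ hγ => ?_
  obtain ⟨g, hg⟩ := hd' γ hγ
  rw [hg]
  exact hp.smul g

/-- An HNN extension along infinite cyclic subgroups inherits a wild action from its base. -/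
theorem IsWildAction.exists_hnnExtension {G Λ : Type*} [Group G] [Group Λ] [Countable Λ] {j : G →* Λ}
    {M : Type} [TopologicalSpace M] [MulAction Λ M] (h : IsWildAction j M) {A B : Subgroup Λ}
    (φ : A ≃* B) {a b : Λ} (ha : ¬ IsOfFinOrder a) (hb : ¬ IsOfFinOrder b)
    (hA : A = Subgroup.zpowers a) (hB : B = Subgroup.zpowers b) :
    ∃ (N : Type) (_ : TopologicalSpace N) (_ : MulAction (HNNExtension Λ A B φ) N),
      IsWildAction ((HNNExtension.of : Λ →* HNNExtension Λ A B φ).comp j) N := by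
  obtain ⟨M₁, _, _, h₁, ⟨p, hap, hp⟩, -⟩ := h.exists_isNonconical ha
  obtain ⟨M₂, _, _, h₂, ⟨q, hbq, hq⟩, h₂'⟩ := h₁.exists_isNonconical hb
  -- The quotient made for `b` may identify further points; `p` is replaced by a nonconical point
  -- which is still fixed by `a`.
  obtain ⟨p', hp', hfix⟩ := h₂' p hp
  have := h₂.continuous
  -- The subgroup of sign `-u` must fix `r u`, and sign `-1` denotes `B`; hence `r 1` is the point
  -- fixed by `b`.
  let r : ℤˣ → M₂ := fun u => if u = 1 then q else p'
  have hr : ∀ u, ∀ g ∈ HNNExtension.toSubgroup A B (-u), g • r u = r u := by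
    intro u g hg
    rcases Int.units_eq_one_or u with rfl | rfl
    · rw [HNNExtension.toSubgroup_neg_one, hB] at hg
      obtain ⟨k, rfl⟩ := hg
      simpa [r] using zpow_smul_of_smul_eq hbq k
    · rw [neg_neg, HNNExtension.toSubgroup_one, hA] at hg
      obtain ⟨k, rfl⟩ := hg
      simpa [r] using zpow_smul_of_smul_eq (hfix a hap) k
  obtain ⟨d, short, hd, hd'⟩ := HNNExtension.exists_isDirectionSystem (φ := φ) r hr
  refine h₂.exists_of_isDirectionSystem hd fun γ hγ => ?_
  obtain ⟨g, u, hg⟩ := hd' γ hγ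
  rw [hg]
  refine IsNonconical.smul ?_ g
  by_cases hu : u = 1 <;> simp [r, hu, hp', hq]

/-! ### Graphs of groups -/

namespace GraphOfGroups

variable {V E : Type*} (Y : GraphOfGroups V E) (T : Set E)

/-- The canonical map of a vertex group to the fundamental group. -/
def vertPi (w : V) : Y.G w →* Y.PiOne T :=
  (QuotientGroup.mk' _).comp (Y.vert w)

/-- The class of the letter of an edge in the fundamental group. -/
def letterPi (e : E) : Y.PiOne T :=
  QuotientGroup.mk' _ (Y.letter e)

theorem letterPi_conj (e : E) (a : Y.A e) :
    Y.letterPi T e * Y.vertPi T (Y.tgt e) (Y.toTgt e a) * (Y.letterPi T e)⁻¹ =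
      Y.vertPi T (Y.src e) (Y.toSrc e a) := by
  have : QuotientGroup.mk' (Subgroup.normalClosure (Y.relators T))
      (Y.letter e * Y.vert (Y.tgt e) (Y.toTgt e a) * (Y.letter e)⁻¹ *
      (Y.vert (Y.src e) (Y.toSrc e a))⁻¹) = 1 :=
    (QuotientGroup.eq_one_iff _).2 (Subgroup.subset_normalClosure (Or.inl ⟨e, a, rfl⟩))
  rw [map_mul, map_mul, map_mul, map_inv, map_inv, mul_inv_eq_one] at this
  exact this

variable {T} in
theorem letterPi_eq_one {e : E} (he : e ∈ T) : Y.letterPi T e = 1 :=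
  (QuotientGroup.eq_one_iff _).2 (Subgroup.subset_normalClosure (Or.inr ⟨e, he, rfl⟩))

/-- Homomorphisms out of the fundamental group. -/
theorem exists_lift {Λ : Type*} [Group Λ] (f : ∀ w, Y.G w →* Λ) (t : E → Λ)
    (h : ∀ e (a : Y.A e), t e * f _ (Y.toTgt e a) * (t e)⁻¹ = f _ (Y.toSrc e a))
    (hT : ∀ e ∈ T, t e = 1) : ∃ ψ : Y.PiOne T →* Λ,
      (∀ w g, ψ (Y.vertPi T w g) = f w g) ∧ ∀ e, ψ (Y.letterPi T e) = t e := by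
  let F : Y.FreeProd →* Λ := Monoid.Coprod.lift (Monoid.CoprodI.lift f) (FreeGroup.lift t)
  have hv : ∀ w g, F (Y.vert w g) = f w g := fun w g => by simp [F, vert]
  have hl : ∀ e, F (Y.letter e) = t e := fun e => by simp [F, letter]
  have hN : Subgroup.normalClosure (Y.relators T) ≤ F.ker := by
    refine Subgroup.normalClosure_le_normal ?_
    rintro _ (⟨e, a, rfl⟩ | ⟨e, he, rfl⟩)
    · rw [SetLike.mem_coe, MonoidHom.mem_ker, map_mul, map_mul, map_mul, map_inv, map_inv, hv, hv, hl,
        h, mul_inv_cancel]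
    · rw [SetLike.mem_coe, MonoidHom.mem_ker, hl, hT e he]
  exact ⟨QuotientGroup.lift _ F hN, fun w g => hv w g, fun e => hl e⟩

theorem hom_ext {Λ : Type*} [Group Λ] {f g : Y.PiOne T →* Λ}
    (h : ∀ w x, f (Y.vertPi T w x) = g (Y.vertPi T w x))
    (h' : ∀ e, f (Y.letterPi T e) = g (Y.letterPi T e)) : f = g := by
  refine QuotientGroup.monoidHom_ext _ (Monoid.Coprod.hom_ext ?_ ?_)
  · exact Monoid.CoprodI.ext_hom _ _ fun w => MonoidHom.ext fun x => h w x
  · exact FreeGroup.ext_hom _ _ fun e => h' e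

/-- A forest admits a potential for any labelling of its edges. -/
theorem exists_potential {Λ : Type*} [Group Λ] (t : E → Λ) {S : Set E} (hS : S.Finite)
    (hbridge : ∀ e ∈ S, ¬ Relation.EqvGen
      (fun a b => ∃ e' ∈ S \ {e}, Y.src e' = a ∧ Y.tgt e' = b) (Y.src e) (Y.tgt e)) :
    ∃ τ : V → Λ, ∀ e ∈ S, τ (Y.tgt e) = τ (Y.src e) * t e := by
  classical
  induction S, hS using Set.Finite.induction_on with
  | empty => exact ⟨fun _ => 1, by simp⟩
  | @insert e S he _ ih =>
    obtain ⟨τ, hτ⟩ := ih fun e' he' h => hbridge e' (Or.inr he') (h.mono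
      fun a b ⟨e'', h1, h2⟩ => ⟨e'', ⟨Or.inr h1.1, h1.2⟩, h2⟩)
    have he' : ¬ Relation.EqvGen (fun a b => ∃ e' ∈ S, Y.src e' = a ∧ Y.tgt e' = b)
        (Y.src e) (Y.tgt e) := fun h => hbridge e (Or.inl rfl) (h.mono
      fun a b ⟨e'', h1, h2⟩ => ⟨e'', ⟨Or.inr h1, fun h3 => he (h3 ▸ h1)⟩, h2⟩)
    let C : V → Prop := fun w =>
      Relation.EqvGen (fun a b => ∃ e' ∈ S, Y.src e' = a ∧ Y.tgt e' = b) w (Y.tgt e)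
    -- Left multiplication by `x` on the component of the target of `e` corrects the relation at
    -- `e`; edges of `S` have both ends on the same side, where a common left factor is harmless.
    let x : Λ := τ (Y.src e) * t e * (τ (Y.tgt e))⁻¹
    refine ⟨fun w => if C w then x * τ w else τ w, ?_⟩
    rintro e' (rfl | he'S)
    · have h1 : C (Y.tgt e') := Relation.EqvGen.refl _
      change (if C _ then _ else _) = (if C _ then _ else _) * _
      rw [if_pos h1, if_neg he']
      simp [x]
    · have hadj : Relation.EqvGen (fun a b => ∃ e' ∈ S, Y.src e' = a ∧ Y.tgt e' = b)
          (Y.src e') (Y.tgt e') := Relation.EqvGen.rel _ _ ⟨e', he'S, rfl, rfl⟩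
      have hiff : C (Y.src e') ↔ C (Y.tgt e') :=
        ⟨fun h => (hadj.symm).trans _ _ _ h, fun h => hadj.trans _ _ _ h⟩
      change (if C _ then _ else _) = (if C _ then _ else _) * _
      by_cases hC : C (Y.src e')
      · rw [if_pos hC, if_pos (hiff.1 hC), hτ e' he'S, ← mul_assoc]
      · rw [if_neg hC, if_neg (fun h => hC (hiff.2 h)), hτ e' he'S]

variable {T} in
-- If the ends of `e` could be joined without `e`, each use of `e` could be rerouted, contradicting
-- minimality.
theorem IsSpanningTree.not_eqvGen (hT : Y.IsSpanningTree T) {e : E} (he : e ∈ T) :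
    ¬ Relation.EqvGen
      (fun a b => ∃ e' ∈ T \ {e}, Y.src e' = a ∧ Y.tgt e' = b) (Y.src e) (Y.tgt e) := by
  intro h
  have hcon : Y.Connects (T \ {e}) := by
    intro v w
    have := hT.prop v w
    induction this with
    | rel a b hab =>
      obtain ⟨e', he', rfl, rfl⟩ := hab
      by_cases hee : e' = e
      · rw [hee]
        exact h
      · exact Relation.EqvGen.rel _ _ ⟨e', ⟨he', hee⟩, rfl, rfl⟩
    | refl a => exact Relation.EqvGen.refl a
    | symm a b _ ih => exact Relation.EqvGen.symm _ _ ih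
    | trans a b c _ _ ih ih' => exact Relation.EqvGen.trans _ _ _ ih ih'
  exact (hT.le_of_le hcon Set.sdiff_subset he).2 rfl

/-- The group obtained from the free product of the vertex groups by adjoining stable letters for a
set `S` of edges. It acts wildly and retracts to the fundamental group. -/
theorem exists_adjoin_letters.{u₁, u₂, u₃, u₄} {V : Type u₁} {E : Type u₂}
    (Y : GraphOfGroups.{u₁, u₂, u₃, u₄} V E) (T : Set E) [Countable V] (hcount : ∀ v, Countable (Y.G v))
    (hedge : ∀ e, IsCyclic (Y.A e) ∧ Infinite (Y.A e)) (v : V) {M : Type} [TopologicalSpace M]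
    [MulAction (Y.G v) M] (hM : IsWildAction (MonoidHom.id (Y.G v)) M) {c : Y.G v}
    (hc : ¬ IsOfFinOrder c) {S : Set E} (hS : S.Finite) :
    ∃ (Λ : Type (max u₁ u₃)) (_ : Group Λ) (f : ∀ w, Y.G w →* Λ) (t : E → Λ) (ρ : Λ →* Y.PiOne T),
      Countable Λ ∧ (∀ w, Function.Injective (f w)) ∧
      (∀ e ∈ S, ∀ a : Y.A e, t e * f _ (Y.toTgt e a) * (t e)⁻¹ = f _ (Y.toSrc e a)) ∧
      (∀ w g, ρ (f w g) = Y.vertPi T w g) ∧ (∀ e ∈ S, ρ (t e) = Y.letterPi T e) ∧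
      ∃ (N : Type) (_ : TopologicalSpace N) (_ : MulAction Λ N), IsWildAction (f v) N := by
  classical
  induction S, hS using Set.Finite.induction_on with
  | empty =>
    exact ⟨Monoid.CoprodI Y.G, inferInstance, fun w => Monoid.CoprodI.of, fun _ => 1,
      Monoid.CoprodI.lift (Y.vertPi T), inferInstance, Monoid.CoprodI.of_injective, by simp,
      fun w g => Monoid.CoprodI.lift_of _ _, by simp, hM.exists_coprodI hc⟩
  | @insert e S he _ ih =>
    obtain ⟨Λ, _, f, t, ρ, hΛ, hf, hrel, hρf, hρt, N, _, _, hN⟩ := ih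
    obtain ⟨hcyc, hinf⟩ := hedge e
    obtain ⟨a, ha⟩ := hcyc
    let α : Y.A e →* Λ := (f _).comp (Y.toTgt e)
    let β : Y.A e →* Λ := (f _).comp (Y.toSrc e)
    have hα : Function.Injective α := (hf _).comp (Y.toTgt_injective e)
    have hβ : Function.Injective β := (hf _).comp (Y.toSrc_injective e)
    have hafin : ¬ IsOfFinOrder a := by
      intro h
      have hz : (Subgroup.zpowers a : Set (Y.A e)).Finite := finite_zpowers.2 h
      have huniv : (Subgroup.zpowers a : Set (Y.A e)) = Set.univ := Set.eq_univ_of_forall ha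
      rw [huniv] at hz
      exact Set.infinite_univ hz
    -- The stable letter conjugates the image of the edge group at the target to its image at the
    -- source, as in the defining relators.
    let φ : α.range ≃* β.range :=
      (MonoidHom.ofInjective hα).symm.trans (MonoidHom.ofInjective hβ)
    have hφ : ∀ x : Y.A e, (φ ⟨α x, x, rfl⟩ : Λ) = β x := by
      intro x
      have : (⟨α x, x, rfl⟩ : α.range) = MonoidHom.ofInjective hα x := rfl
      rw [this]
      change (MonoidHom.ofInjective hβ ((MonoidHom.ofInjective hα).symm _) : Λ) = _
      rw [MulEquiv.symm_apply_apply]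
      rfl
    have hgen : ∀ γ : Y.A e →* Λ, γ.range = Subgroup.zpowers (γ a) := by
      intro γ
      rw [MonoidHom.range_eq_map, ← (Subgroup.eq_top_iff' (Subgroup.zpowers a)).2 ha, MonoidHom.map_zpowers]
    have hN' := hN.exists_hnnExtension φ (a := α a) (b := β a)
      (fun h => hafin ((hα.isOfFinOrder_iff (f := α)).1 h))
      (fun h => hafin ((hβ.isOfFinOrder_iff (f := β)).1 h)) (hgen α) (hgen β)
    let ρ' : HNNExtension Λ α.range β.range φ →* Y.PiOne T :=
      HNNExtension.lift ρ (Y.letterPi T e) (by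
        rintro ⟨_, x, rfl⟩
        rw [hφ]
        simp only [α, β, MonoidHom.comp_apply, hρf, ← Y.letterPi_conj T e x, inv_mul_cancel_right])
    refine ⟨HNNExtension Λ α.range β.range φ, inferInstance, fun w => HNNExtension.of.comp (f w),
      Function.update (fun e' => HNNExtension.of (t e')) e HNNExtension.t, ρ', inferInstance,
      fun w => (HNNExtension.of_injective φ).comp (hf w), ?_, ?_, ?_, hN'⟩
    · rintro e' (rfl | he') x
      · have := HNNExtension.t_mul_of (φ := φ) ⟨α x, x, rfl⟩
        rw [hφ] at this
        rw [Function.update_self]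
        exact mul_inv_eq_of_eq_mul this
      · rw [Function.update_of_ne (ne_of_mem_of_not_mem he' he)]
        simp only [MonoidHom.comp_apply, ← map_mul, ← map_inv, hrel e' he' x]
    · intro w g
      simp [ρ', hρf]
    · rintro e' (rfl | he')
      · rw [Function.update_self]
        simp [ρ']
      · rw [Function.update_of_ne (ne_of_mem_of_not_mem he' he)]
        simp [ρ', hρt e' he']

/-- The fundamental group acts wildly as soon as one of the vertex groups does. -/
theorem exists_isWildAction [Countable V] [Finite E] {T : Set E} (hT : Y.IsSpanningTree T)
    (hcount : ∀ v, Countable (Y.G v))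
    (hedge : ∀ e, IsCyclic (Y.A e) ∧ Infinite (Y.A e)) (v : V) {M : Type} [TopologicalSpace M]
    [MulAction (Y.G v) M] (hM : IsWildAction (MonoidHom.id (Y.G v)) M) {c : Y.G v}
    (hc : ¬ IsOfFinOrder c) :
    Function.Injective (Y.vertPi T v) ∧
      ∃ (N : Type) (_ : TopologicalSpace N) (_ : MulAction (Y.PiOne T) N),
        IsWildAction (Y.vertPi T v) N := by
  obtain ⟨Λ, _, f, t, ρ, hΛ, hf, hrel, hρf, hρt, N, _, _, hN⟩ :=
    Y.exists_adjoin_letters T hcount hedge v hM hc (Set.finite_univ (α := E))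
  obtain ⟨τ₀, hτ₀⟩ := Y.exists_potential t (Set.toFinite T)
    (fun e he => IsSpanningTree.not_eqvGen Y hT he)
  -- The normalization `τ v = 1` makes the embedding ψ below restrict to `f v` on `G v`, the group
  -- with respect to which the action is wild.
  let τ : V → Λ := fun w => (τ₀ v)⁻¹ * τ₀ w
  have hτv : τ v = 1 := inv_mul_cancel _
  have hτ : ∀ e ∈ T, τ (Y.tgt e) = τ (Y.src e) * t e := fun e he => by
    simp only [τ, hτ₀ e he, mul_assoc]
  have hρτ : ∀ w, ρ (τ w) = 1 := by
    have key : ∀ w w', Relation.EqvGen (fun a b => ∃ e ∈ T, Y.src e = a ∧ Y.tgt e = b) w w' →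
        ρ (τ w) = ρ (τ w') := by
      intro w w' h
      induction h with
      | rel a b hab =>
        obtain ⟨e, he, rfl, rfl⟩ := hab
        rw [hτ e he, map_mul ρ (τ _) (t e), hρt e trivial, Y.letterPi_eq_one he, mul_one]
      | refl a => rfl
      | symm a b _ ih => exact ih.symm
      | trans a b c _ _ ih ih' => exact ih.trans ih'
    intro w
    rw [key w v (hT.prop w v), hτv, map_one]
  -- Conjugating each vertex group by its potential makes the images of the tree letters trivial.
  -- Since ρ kills the potentials, it is a left inverse of ψ.
  obtain ⟨ψ, hψv, hψe⟩ := Y.exists_lift T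
    (fun w => (MulAut.conj (τ w)).toMonoidHom.comp (f w))
    (fun e => τ (Y.src e) * t e * (τ (Y.tgt e))⁻¹) (by
      intro e a
      simp only [MonoidHom.comp_apply, MulEquiv.toMonoidHom_eq_coe, MonoidHom.coe_coe,
        MulAut.conj_apply, ← hrel e trivial a]
      group) (by
      intro e he
      simp only [hτ e he]
      group)
  have hid : ρ.comp ψ = MonoidHom.id _ := by
    refine Y.hom_ext T (fun w x => ?_) fun e => ?_
    · simp [hψv, hρτ, hρf]
    · simp [hψe, hρτ, hρt]
  have hψ : Function.Injective ψ := by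
    have : Function.LeftInverse ρ ψ := fun x => DFunLike.congr_fun hid x
    exact this.injective
  have hcomp : ψ.comp (Y.vertPi T v) = f v := by
    ext x
    simp [hψv, hτv]
  refine ⟨fun x y h => hf v ?_, N, _, _, hN.compHom ψ hψ hcomp⟩
  rw [← hcomp, MonoidHom.comp_apply, MonoidHom.comp_apply, h]

end GraphOfGroups

theorem proposition5p3 {V E : Type*} [Finite V] [Nonempty V] [Finite E]
    (Y : GraphOfGroups V E) (T : Set E) (hT : Y.IsSpanningTree T)
    (hcount : ∀ v, Countable (Y.G v))
    (htf : ∀ (v : V) (g : Y.G v), IsOfFinOrder g → g = 1)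
    (hconv : ∀ v, IsConvergenceGroup (Y.G v))
    (hedge : ∀ e, IsCyclic (Y.A e) ∧ Infinite (Y.A e)) :
    IsConvergenceGroup (Y.PiOne T) ∧
      ((∃ v, IsNonelementaryConvergenceGroup (Y.G v)) →
        IsNonelementaryConvergenceGroup (Y.PiOne T)) := by
  have hΓ : Countable (Y.PiOne T) :=
    (QuotientGroup.mk'_surjective (Subgroup.normalClosure (Y.relators T))).countable
  refine ⟨isConvergenceGroup_of_countable _, fun ⟨v, hv⟩ => ?_⟩
  obtain ⟨hinf, M, _, _, hM⟩ := exists_isWildAction_of_isNonelementary hv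
  -- Torsion-freeness turns any nontrivial element into one of infinite order, which supplies the
  -- base point for the free product.
  obtain ⟨c, hc⟩ := exists_ne (1 : Y.G v)
  obtain ⟨hinj, N, _, _, hN⟩ := Y.exists_isWildAction hT hcount hedge v hM
    (c := c) fun h => hc (htf v c h)
  have hNi := hN.infinite
  refine ⟨N, inferInstance, inferInstance, hN.compact, hN.metrizable, hN.continuous, by simp,
    hN.convergence, Infinite.of_injective _ hinj, fun F hF hF2 => ?_⟩
  obtain ⟨g, x, hx, hg⟩ := hN.not_invariant F (Set.finite_of_encard_le_coe (k := 2) hF2) hF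
  exact ⟨_, x, hx, hg⟩
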